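/- **Corollary 1 (robustness of the IPA state derivatives).** *Known data.* Fix $T>0$, targets $w_1,\dots,w_M\in\mathbb R^2$, a base $w_B\in\mathbb R^2$, ranges $r_{ij},r_{Bj}$ with $\|w_i-w_B\|>r_{ij}+r_{Bj}$, and maximal collection and delivery rates $\mu_{ij},\beta_{ij}\ge 0$ ($i=1,\dots,M$, $j=1,\dots,N$). Agent $j$ moves along $s_j(t)=(f_j(\Theta_j,\rho_j(t)),g_j(\Theta_j,\rho_j(t)))$, where $\Theta=[\Theta_1,\dots,\Theta_N]$ is the controllable parameter vector, $\Theta_j\in\mathbb R^{d_j}$, and $\rho_j$ may depend on $\Theta_j$; $s_j$ is continuous in $t$ and, near the observed parameter value $\Theta^0$, Lipschitz in $\Theta$ uniformly in $t\in[0,T]$. Put $D_{ij}(t)=\|w_i-s_j(t)\|$, $D_{Bj}(t)=\|w_B-s_j(t)\|$, $D_{ij}^+=\max(0,D_{ij}-r_{ij})$, $D_{Bj}^+=\max(0,D_{Bj}-r_{Bj})$. The rates $P_{ij}(t)=p_{ij}(D_{ij}(t))$ and $P_{Bj}(t)=p_{Bj}(D_{Bj}(t))$ are non-increasing and continuous functions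 of the distance that vanish when the distance exceeds $r_{ij}$, resp. $r_{Bj}$, and $p_{ij}$ is Lipschitz. At each time at most one agent is connected to target $i$; it is within range of $i$ and stays connected as long as it remains within range; and if no agent enters or leaves the range of $i$ at time $t$ under $\Theta^0$, then the connection to $i$ is constant near $(\Theta^0,t)$. The connections are determined by $\Theta$ and $t$, not by the arrivals. *Dynamics.* Let $\sigma_1,\dots,\sigma_M\ge 0$ be random arrival rate processes on a probability space, with piecewise continuous paths on $[0,T]$. For every $\Theta$ in a neighbourhood of $\Theta^0$ the queue contents $X_i,Z_{ij},Y_i\ge 0$ are continuous in $t$, start from given initial values that are functions of $\Theta$ differentiable at $\Theta^0$, and satisfy, except at finitely many times, $$\dot X_i=\begin{cases}0&\text{if }X_i=0,\ \sigma_i\le\mu_{ij}P_{ij}\\ \sigma_i-\mu_{ij}P_{ij}&\text{otherwise}\end{cases}\qquad \dot Z_{ij}=\begin{cases}0&\text{if }Z_{ij}=0,\ \tilde\mu_{ij}P_{ij}-\beta_{ij}P_{Bj}\le 0\\ \tilde\mu_{ij}P_{ij}-\beta_{ij}P_{Bj}&\text{otherwise}\end{cases}$$ $$\dot Y_i=\sum_{j}\beta_{ij}P_{Bj}\mathbf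 1[Z_{ij}>0],$$ where in the first equation $j$ is the agent connected to $i$ (with $\mu_{ij}P_{ij}$ replaced by $0$ if there is none), and $\tilde\mu_{ij}=\min(\sigma_i/P_{ij},\mu_{ij})$ if $j$ is connected to $i$, $X_i=0$ and $P_{ij}>0$; $\tilde\mu_{ij}=\mu_{ij}$ if $j$ is connected to $i$ otherwise; $\tilde\mu_{ij}=0$ if $j$ is not connected to $i$. *Events.* A function hits $0$ at $\tau$ if it is positive just before $\tau$ and zero at $\tau$; it leaves $0$ at $\tau$ if it is zero at $\tau$ and positive just after $\tau$. The observed events under $\Theta^0$ are: $X_i$ hits or leaves $0$; $Z_{ij}$ hits $0$; $Z_{ij}$ leaves $0$ while $X_i=0$; $D_{ij}^+$ hits or leaves $0$; $D_{Bj}^+$ hits or leaves $0$. Assume that, with probability one, there are finitely many events in $[0,T]$, that no two distinct events (other than "$Z_{ij}$ leaves $0$ while $X_i=0$") occur at the same time, and that at every $t\in[0,T]$ that is not an event time $X_i(t)$ and $Z_{ij}(t)$ are differentiable with respect to $\Theta$ at $\Theta^0$. *Claim.* The state derivatives $X_i'(t)$, $Z_{ij}'(t)$, $Y_i'(t)$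 with respect to $\Theta$ at $\Theta^0$ are independent of the arrival processes $\{\sigma_i(t)\}$, except through the observed event times. That is, there are maps $\Phi^X_i,\Phi^Z_{ij},\Phi^Y_i$, determined by the known data and $\Theta^0$ alone, such that for every probability space and all arrival processes and queue contents as above, with probability one, for every $t\in[0,T]$ that is not an event time, $X_i(t)$, $Z_{ij}(t)$ and $Y_i(t)$ are differentiable with respect to $\Theta$ at $\Theta^0$ and $$X_i'(t)=\Phi^X_i(\mathcal E,t),\qquad Z_{ij}'(t)=\Phi^Z_{ij}(\mathcal E,t),\qquad Y_i'(t)=\Phi^Y_i(\mathcal E,t),$$ where $\mathcal E$ is the record of the times at which each of the events occurs on the observed sample path. -/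

import Mathlib

open Set Filter Topology MeasureTheory

noncomputable section

namespace DataHarvesting

/-- The plane containing the mission space. -/
abbrev Plane : Type := EuclideanSpace ℝ (Fin 2)

/-- The parameter vector `Θ = [Θ₁, …, Θ_N]`, where `Θ_j` has `d j` real components. -/
abbrev Params {N : ℕ} (d : Fin N → ℕ) : Type := ∀ j : Fin N, EuclideanSpace ℝ (Fin (d j))

/-- The known (deterministic) data of a harvesting problem with `M` targets and `N` agents. -/
structure Setting (M N : ℕ) (d : Fin N → ℕ) where
  /-- target locations -/
  w : Fin M → Plane
  /-- base location -/
  wB : Plane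
  /-- collection ranges -/
  r : Fin M → Fin N → ℝ
  /-- delivery ranges -/
  rB : Fin N → ℝ
  /-- collection rate, as a function of the distance between target and agent -/
  p : Fin M → Fin N → ℝ → ℝ
  /-- delivery rate, as a function of the distance between base and agent -/
  pB : Fin N → ℝ → ℝ
  /-- maximal collection rates -/
  μ : Fin M → Fin N → ℝ
  /-- maximal delivery rates -/
  β : Fin M → Fin N → ℝ
  /-- `f`, `g`, `ρ` parametrize the trajectories:
  `s_j(t) = (f(Θ_j, ρ_j(t)), g(Θ_j, ρ_j(t)))`, where `ρ_j` may itself depend on `Θ_j` -/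
  f : ∀ j : Fin N, EuclideanSpace ℝ (Fin (d j)) → ℝ → ℝ
  g : ∀ j : Fin N, EuclideanSpace ℝ (Fin (d j)) → ℝ → ℝ
  ρ : ∀ j : Fin N, EuclideanSpace ℝ (Fin (d j)) → ℝ → ℝ
  /-- the agent (at most one) that is connected to target `i` at time `t` -/
  conn : Params d → ℝ → Fin M → Option (Fin N)
  /-- initial contents of the queues -/
  x₀ : Fin M → Params d → ℝ
  z₀ : Fin M → Fin N → Params d → ℝ
  y₀ : Fin M → Params d → ℝ

/-- `h` hits `0` at time `τ`: it is positive just before `τ` and zero at `τ`. -/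
def HitsZero (T : ℝ) (h : ℝ → ℝ) (τ : ℝ) : Prop :=
  0 < τ ∧ τ ≤ T ∧ h τ = 0 ∧ ∀ᶠ u in 𝓝[<] τ, 0 < h u

/-- `h` leaves `0` at time `τ`: it is zero at `τ` and positive just after `τ`. -/
def LeavesZero (T : ℝ) (h : ℝ → ℝ) (τ : ℝ) : Prop :=
  0 ≤ τ ∧ τ < T ∧ h τ = 0 ∧ ∀ᶠ u in 𝓝[>] τ, 0 < h u

/-- Piecewise continuity on `[0, T]`: finitely many discontinuities, with one-sided limits. -/
def PiecewiseContinuous (T : ℝ) (h : ℝ → ℝ) : Prop :=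
  (∃ S : Set ℝ, S.Finite ∧ ContinuousOn h (Icc 0 T \ S)) ∧
    ∀ t ∈ Icc 0 T, (∃ l, Tendsto h (𝓝[Icc 0 T ∩ Iio t] t) (𝓝 l)) ∧
      ∃ l, Tendsto h (𝓝[Icc 0 T ∩ Ioi t] t) (𝓝 l)

/-- The observable events. `zetaPlus i j` stands only for those departures of `Z_ij` from `0`
that take place while `X_i = 0`; a departure while `X_i > 0` is induced by the motion of the
agents and is not recorded. -/
inductive Event (M N : ℕ) : Type
  | xiZero (i : Fin M)
  | xiPlus (i : Fin M)
  | zetaZero (i : Fin M) (j : Fin N)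
  | zetaPlus (i : Fin M) (j : Fin N)
  | deltaPlus (i : Fin M) (j : Fin N)
  | deltaZero (i : Fin M) (j : Fin N)
  | basePlus (j : Fin N)
  | baseZero (j : Fin N)

namespace Setting

variable {M N : ℕ} {d : Fin N → ℕ} (S : Setting M N d)

/-- Position of agent `j`. -/
def s (j : Fin N) (Θ : Params d) (t : ℝ) : Plane :=
  !₂[S.f j (Θ j) (S.ρ j (Θ j) t), S.g j (Θ j) (S.ρ j (Θ j) t)]

/-- `D_ij(t)` -/
def D (i : Fin M) (j : Fin N) (Θ : Params d) (t : ℝ) : ℝ := dist (S.w i) (S.s j Θ t)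

/-- `D_Bj(t)` -/
def DB (j : Fin N) (Θ : Params d) (t : ℝ) : ℝ := dist S.wB (S.s j Θ t)

/-- `D_ij⁺(t)` -/
def Dplus (i : Fin M) (j : Fin N) (Θ : Params d) (t : ℝ) : ℝ := max 0 (S.D i j Θ t - S.r i j)

/-- `D_Bj⁺(t)` -/
def DBplus (j : Fin N) (Θ : Params d) (t : ℝ) : ℝ := max 0 (S.DB j Θ t - S.rB j)

/-- `P_ij(t)` -/
def P (i : Fin M) (j : Fin N) (Θ : Params d) (t : ℝ) : ℝ := S.p i j (S.D i j Θ t)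

/-- `P_Bj(t)` -/
def PB (j : Fin N) (Θ : Params d) (t : ℝ) : ℝ := S.pB j (S.DB j Θ t)

/-- `μ_ij P_ij(t)` for the agent `j` connected to target `i`, and `0` if there is none. -/
def drain (i : Fin M) (Θ : Params d) (t : ℝ) : ℝ :=
  match S.conn Θ t i with
  | none => 0
  | some j => S.μ i j * S.P i j Θ t

/-- Right-hand side of the dynamics of `X_i`, for arrival rate `a` and content `x`. -/
def Xdot (i : Fin M) (Θ : Params d) (t a x : ℝ) : ℝ :=
  if x = 0 ∧ a ≤ S.drain i Θ t then 0 else a - S.drain i Θ t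

/-- The effective collection rate of agent `j` at target `i`; it vanishes if `j` is not
connected to `i`. -/
def muTilde (i : Fin M) (j : Fin N) (Θ : Params d) (t a x : ℝ) : ℝ :=
  if S.conn Θ t i = some j then
    if x = 0 ∧ 0 < S.P i j Θ t then min (a / S.P i j Θ t) (S.μ i j) else S.μ i j
  else 0

/-- `μ̃_ij P_ij - β_ij P_Bj` -/
def netFlow (i : Fin M) (j : Fin N) (Θ : Params d) (t a x : ℝ) : ℝ :=
  S.muTilde i j Θ t a x * S.P i j Θ t - S.β i j * S.PB j Θ t

/-- Right-hand side of the dynamics of `Z_ij`, for on-board content `z`. -/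
def Zdot (i : Fin M) (j : Fin N) (Θ : Params d) (t a x z : ℝ) : ℝ :=
  if z = 0 ∧ S.netFlow i j Θ t a x ≤ 0 then 0 else S.netFlow i j Θ t a x

/-- Right-hand side `β_i` of the dynamics of `Y_i`, for on-board contents `z`. -/
def Ydot (i : Fin M) (Θ : Params d) (t : ℝ) (z : Fin N → ℝ) : ℝ :=
  ∑ j, if 0 < z j then S.β i j * S.PB j Θ t else 0

/-- Standing assumptions on the known data near the parameter `Θ₀`, on the horizon `[0, T]`
and the feasible set `F`. -/
structure Admissible (T : ℝ) (F : Set (Params d)) (Θ₀ : Params d) : Prop where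
  /-- rates are non-increasing in the distance, vanish out of range, and are continuous;
  the collection rates are Lipschitz in the distance -/
  p_anti : ∀ i j, AntitoneOn (S.p i j) (Ici 0)
  p_zero : ∀ i j, ∀ x, 0 ≤ x → S.r i j < x → S.p i j x = 0
  p_lip : ∀ i j, ∃ K, LipschitzOnWith K (S.p i j) (Ici 0)
  pB_anti : ∀ j, AntitoneOn (S.pB j) (Ici 0)
  pB_zero : ∀ j, ∀ x, 0 ≤ x → S.rB j < x → S.pB j x = 0
  pB_cont : ∀ j, ContinuousOn (S.pB j) (Ici 0)
  μ_nonneg : ∀ i j, 0 ≤ S.μ i j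
  β_nonneg : ∀ i j, 0 ≤ S.β i j
  /-- an agent cannot collect and deliver at the same time -/
  separated : ∀ i j, S.r i j + S.rB j < dist (S.w i) S.wB
  /-- trajectories are continuous in time, and Lipschitz in the parameter near `Θ₀` -/
  s_cont : ∀ j, ∀ Θ ∈ F, ContinuousOn (S.s j Θ) (Icc 0 T)
  s_lip : ∀ j, ∃ K, ∃ V ∈ 𝓝 Θ₀, ∀ t ∈ Icc 0 T, LipschitzOnWith K (fun Θ => S.s j Θ t) V
  /-- only an agent within range is connected -/
  conn_range : ∀ Θ ∈ F, ∀ t ∈ Icc 0 T, ∀ i j, S.conn Θ t i = some j → S.D i j Θ t ≤ S.r i j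
  /-- a connected agent stays connected as long as it stays within range -/
  conn_persist : ∀ Θ ∈ F, ∀ t ∈ Icc 0 T, ∀ t' ∈ Icc t T, ∀ i j, S.conn Θ t i = some j →
    (∀ u ∈ Icc t t', S.D i j Θ u ≤ S.r i j) → S.conn Θ t' i = some j
  /-- the connection to target `i` switches only where an agent enters or leaves its range -/
  conn_locConst : ∀ i, ∀ t ∈ Icc 0 T,
    (∀ j, ¬ HitsZero T (S.Dplus i j Θ₀) t ∧ ¬ LeavesZero T (S.Dplus i j Θ₀) t) →
    ∀ᶠ q in 𝓝[univ ×ˢ Icc 0 T] (Θ₀, t), S.conn q.1 q.2 i = S.conn Θ₀ t i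
  x₀_nonneg : ∀ i, ∀ Θ ∈ F, 0 ≤ S.x₀ i Θ
  z₀_nonneg : ∀ i j, ∀ Θ ∈ F, 0 ≤ S.z₀ i j Θ
  y₀_nonneg : ∀ i, ∀ Θ ∈ F, 0 ≤ S.y₀ i Θ
  x₀_diff : ∀ i, DifferentiableAt ℝ (S.x₀ i) Θ₀
  z₀_diff : ∀ i j, DifferentiableAt ℝ (S.z₀ i j) Θ₀
  y₀_diff : ∀ i, DifferentiableAt ℝ (S.y₀ i) Θ₀

/-- `(x, z, y)` is the state trajectory on `[0, T]` for the parameter `Θ` and arrival rates `a`: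
continuous, non-negative, and satisfying the dynamics except at finitely many times. -/
structure IsStatePath (T : ℝ) (Θ : Params d) (a : Fin M → ℝ → ℝ)
    (x : Fin M → ℝ → ℝ) (z : Fin M → Fin N → ℝ → ℝ) (y : Fin M → ℝ → ℝ) : Prop where
  x_cont : ∀ i, ContinuousOn (x i) (Icc 0 T)
  z_cont : ∀ i j, ContinuousOn (z i j) (Icc 0 T)
  y_cont : ∀ i, ContinuousOn (y i) (Icc 0 T)
  x_nonneg : ∀ i, ∀ t ∈ Icc 0 T, 0 ≤ x i t
  z_nonneg : ∀ i j, ∀ t ∈ Icc 0 T, 0 ≤ z i j t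
  y_nonneg : ∀ i, ∀ t ∈ Icc 0 T, 0 ≤ y i t
  x_init : ∀ i, x i 0 = S.x₀ i Θ
  z_init : ∀ i j, z i j 0 = S.z₀ i j Θ
  y_init : ∀ i, y i 0 = S.y₀ i Θ
  dynamics : ∃ C : Set ℝ, C.Finite ∧ ∀ t ∈ Ioo 0 T \ C,
    (∀ i, HasDerivAt (x i) (S.Xdot i Θ t (a i t) (x i t)) t) ∧
    (∀ i j, HasDerivAt (z i j) (S.Zdot i j Θ t (a i t) (x i t) (z i j t)) t) ∧
    ∀ i, HasDerivAt (y i) (S.Ydot i Θ t fun j => z i j t) t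

/-- The set of occurrence times in `[0, T]` of each event, observed for the parameter `Θ`
along the state trajectory `(x, z)`. -/
def eventTimes (T : ℝ) (Θ : Params d) (x : Fin M → ℝ → ℝ) (z : Fin M → Fin N → ℝ → ℝ) :
    Event M N → Set ℝ
  | .xiZero i => {τ | HitsZero T (x i) τ}
  | .xiPlus i => {τ | LeavesZero T (x i) τ}
  | .zetaZero i j => {τ | HitsZero T (z i j) τ}
  | .zetaPlus i j => {τ | LeavesZero T (z i j) τ ∧ x i τ = 0}
  | .deltaPlus i j => {τ | LeavesZero T (S.Dplus i j Θ) τ}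
  | .deltaZero i j => {τ | HitsZero T (S.Dplus i j Θ) τ}
  | .basePlus j => {τ | LeavesZero T (S.DBplus j Θ) τ}
  | .baseZero j => {τ | HitsZero T (S.DBplus j Θ) τ}

/-- The requirements on one realization: `a i t` is the arrival rate, and `x i Θ t`, `z i j Θ t`,
`y i Θ t` are the queue contents at time `t` for the parameter `Θ`. -/
structure IsSamplePath (T : ℝ) (F : Set (Params d)) (Θ₀ : Params d) (a : Fin M → ℝ → ℝ)
    (x : Fin M → Params d → ℝ → ℝ) (z : Fin M → Fin N → Params d → ℝ → ℝ)
    (y : Fin M → Params d → ℝ → ℝ) : Prop where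
  arrival_nonneg : ∀ i, ∀ t ∈ Icc 0 T, 0 ≤ a i t
  arrival_piecewise : ∀ i, PiecewiseContinuous T (a i)
  state : ∀ Θ ∈ F, S.IsStatePath T Θ a (fun i => x i Θ) (fun i j => z i j Θ) (fun i => y i Θ)
  /-- finitely many events occur for the observed parameter `Θ₀` -/
  finite : ∀ e, (S.eventTimes T Θ₀ (fun i => x i Θ₀) (fun i j => z i j Θ₀) e).Finite
  /-- no two events occur at the same time; the departures `zetaPlus`, which are always caused
  by other changes, are exempt -/
  simple : ∀ e e', (∀ i j, e ≠ .zetaPlus i j) → (∀ i j, e' ≠ .zetaPlus i j) → ∀ τ,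
    τ ∈ S.eventTimes T Θ₀ (fun i => x i Θ₀) (fun i j => z i j Θ₀) e →
    τ ∈ S.eventTimes T Θ₀ (fun i => x i Θ₀) (fun i j => z i j Θ₀) e' → e = e'
  /-- the derivatives of `X` and `Z` with respect to the parameter exist between events -/
  diff : ∀ t ∈ Icc 0 T,
    (∀ e, t ∉ S.eventTimes T Θ₀ (fun i => x i Θ₀) (fun i j => z i j Θ₀) e) →
    (∀ i, DifferentiableAt ℝ (fun Θ => x i Θ t) Θ₀) ∧
    ∀ i j, DifferentiableAt ℝ (fun Θ => z i j Θ t) Θ₀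

end Setting

end DataHarvesting

end

/-! ### Mean value inequalities with finitely many exceptional times. -/

namespace DataHarvesting

/-! The maps need no explicit formulas: for each event record that occurs at all, fix one reference
sample path and return its derivatives. What must be shown is that two sample paths with the same
record, but possibly different arrivals, have the same derivatives (`fderiv_x_eq`, `fderiv_z_eq`).

Let `Δ` be the difference of the two derivatives of one queue. It vanishes at time 0, where both
contents are the same function of the parameter, and the value 0 has to be carried past every time
(`eq_zero_of_constNear_or`). Three mechanisms do this. Where the difference of the two contents has
a time derivative free of the parameter, `Δ` is locally constant (`exists_nhds_fderiv_eq`). Where a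
queue is empty, non-negativity puts it at a minimum over the parameter, so its derivative is 0, and
the record fixes when this happens. At the remaining times an increment is bounded above by a
multiple of `‖Θ - Θ₀‖` proportional to the elapsed time, up to a term with zero derivative; a
one-sided bound in all directions bounds the derivative (`norm_fderiv_le_of_sub_le`), so it cannot
jump.

For `X` the last mechanism is needed only when the queue leaves 0. For `Z`, an agent out of range of
the target collects nothing, and one within range delivers nothing. Within range, collection is
fixed by the geometry if `X > 0`, and otherwise `Z + X` of the connected agent grows at the arrival
rate. The delicate case is a switch of the connection at an empty target (`smallJump_fderiv_z`):
one-sided estimates treat every agent not connected afterwards, and the one connected afterwards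
gets the rest of a conserved sum. Finally, `Y'` follows from conservation of data (`hasFDerivAt_y`).
-/

theorem sub_le_mul_sub_of_deriv_le_off_finite {C : Set ℝ} (hC : C.Finite) {f : ℝ → ℝ} {c : ℝ} :
    ∀ {a b : ℝ}, a ≤ b → ContinuousOn f (Icc a b) →
      (∀ s ∈ Ioo a b, s ∉ C → ∃ f', HasDerivAt f f' s ∧ f' ≤ c) → f b - f a ≤ c * (b - a) := by
  induction C, hC using Set.Finite.induction_on with
  | empty =>
    intro a b hab hf h
    refine Convex.image_sub_le_mul_sub_of_deriv_le (convex_Icc a b) hf ?_ ?_ a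
      (left_mem_Icc.2 hab) b (right_mem_Icc.2 hab) hab
    · rw [interior_Icc]
      intro s hs
      obtain ⟨f', h1, -⟩ := h s hs (notMem_empty s)
      exact h1.differentiableAt.differentiableWithinAt
    · rw [interior_Icc]
      intro s hs
      obtain ⟨f', h1, h2⟩ := h s hs (notMem_empty s)
      rwa [h1.deriv]
  | @insert p C _ _ ih =>
    intro a b hab hf h
    by_cases hp : p ∈ Ioo a b
    · have h1 : f p - f a ≤ c * (p - a) := ih hp.1.le (hf.mono (Icc_subset_Icc_right hp.2.le))
        fun s hs hsC => h s ⟨hs.1, hs.2.trans hp.2⟩ (by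
          rintro (rfl | h'); exacts [hs.2.ne rfl, hsC h'])
      have h2 : f b - f p ≤ c * (b - p) := ih hp.2.le (hf.mono (Icc_subset_Icc_left hp.1.le))
        fun s hs hsC => h s ⟨hp.1.trans hs.1, hs.2⟩ (by
          rintro (rfl | h'); exacts [hs.1.ne rfl, hsC h'])
      linarith
    · exact ih hab hf fun s hs hsC => h s hs (by
        rintro (rfl | h'); exacts [hp hs, hsC h'])

theorem sub_eq_sub_of_deriv_eq_off_finite {C : Set ℝ} (hC : C.Finite) {f g : ℝ → ℝ} {a b : ℝ}
    (hab : a ≤ b) (hf : ContinuousOn f (Icc a b)) (hg : ContinuousOn g (Icc a b))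
    (h : ∀ s ∈ Ioo a b, s ∉ C → ∃ f', HasDerivAt f f' s ∧ HasDerivAt g f' s) :
    f b - f a = g b - g a := by
  have h1 := sub_le_mul_sub_of_deriv_le_off_finite (c := 0) hC hab (hf.sub hg) fun s hs hsC => by
    obtain ⟨f', h1, h2⟩ := h s hs hsC
    exact ⟨_, h1.sub h2, by simp⟩
  have h2 := sub_le_mul_sub_of_deriv_le_off_finite (c := 0) hC hab (hg.sub hf) fun s hs hsC => by
    obtain ⟨f', h1, h2⟩ := h s hs hsC
    exact ⟨_, h2.sub h1, by simp⟩
  simp only [Pi.sub_apply] at h1 h2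
  linarith

/-- The last zero before a time at which a continuous function is positive. -/
theorem exists_last_nonpos {f : ℝ → ℝ} {a b : ℝ} (hf : ContinuousOn f (Icc a b))
    (hb : 0 < f b) (h : ∃ s ∈ Icc a b, f s ≤ 0) :
    ∃ s ∈ Ico a b, f s ≤ 0 ∧ ∀ u ∈ Ioc s b, 0 < f u := by
  have hK : IsCompact {s ∈ Icc a b | f s ≤ 0} :=
    isCompact_Icc.of_isClosed_subset (hf.preimage_isClosed_of_isClosed isClosed_Icc isClosed_Iic)
      fun s hs => hs.1
  obtain ⟨s, ⟨hs, hs0⟩, hmax⟩ := hK.exists_isGreatest (by obtain ⟨s, h1, h2⟩ := h; exact ⟨s, h1, h2⟩)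
  refine ⟨s, ⟨hs.1, hs.2.lt_of_ne (by rintro rfl; linarith)⟩, hs0, fun u hu => ?_⟩
  by_contra! hu0
  exact absurd (hmax ⟨⟨hs.1.trans hu.1.le, hu.2⟩, hu0⟩) (not_le.2 hu.1)

theorem exists_first_nonpos {f : ℝ → ℝ} {a b : ℝ} (hf : ContinuousOn f (Icc a b))
    (ha : 0 < f a) (h : ∃ s ∈ Icc a b, f s ≤ 0) :
    ∃ s ∈ Ioc a b, f s ≤ 0 ∧ ∀ u ∈ Ico a s, 0 < f u := by
  have hK : IsCompact {s ∈ Icc a b | f s ≤ 0} :=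
    isCompact_Icc.of_isClosed_subset (hf.preimage_isClosed_of_isClosed isClosed_Icc isClosed_Iic)
      fun s hs => hs.1
  obtain ⟨s, ⟨hs, hs0⟩, hmin⟩ := hK.exists_isLeast (by obtain ⟨s, h1, h2⟩ := h; exact ⟨s, h1, h2⟩)
  refine ⟨s, ⟨hs.1.lt_of_ne (by rintro rfl; linarith), hs.2⟩, hs0, fun u hu => ?_⟩
  by_contra! hu0
  exact absurd (hmin ⟨⟨hu.1, hu.2.le.trans hs.2⟩, hu0⟩) (not_le.2 hu.2)

/-- A function whose slope is at most `c` wherever it is positive. -/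
theorem le_of_deriv_le_of_pos {C : Set ℝ} (hC : C.Finite) {f : ℝ → ℝ} {c : ℝ} (hc : 0 ≤ c)
    {a b : ℝ} (hab : a ≤ b) (hf : ContinuousOn f (Icc a b))
    (h : ∀ s ∈ Ioo a b, s ∉ C → 0 < f s → ∃ f', HasDerivAt f f' s ∧ f' ≤ c) :
    f b ≤ max (f a) 0 + c * (b - a) := by
  rcases le_or_gt (f b) 0 with hb | hb
  · have := mul_nonneg hc (sub_nonneg.2 hab)
    have := le_max_right (f a) 0
    linarith
  by_cases hz : ∃ s ∈ Icc a b, f s ≤ 0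
  -- Only the stretch after the last non-positive time counts: the slope bound holds on all of it,
  -- and it starts from a value at most 0.
  · obtain ⟨s, hs, hs0, hpos⟩ := exists_last_nonpos hf hb hz
    have h1 := sub_le_mul_sub_of_deriv_le_off_finite (c := c) hC hs.2.le
      (hf.mono (Icc_subset_Icc_left hs.1)) fun t ht htC =>
        h t ⟨hs.1.trans_lt ht.1, ht.2⟩ htC (hpos t ⟨ht.1, ht.2.le⟩)
    have h2 : c * (b - s) ≤ c * (b - a) := by gcongr; exact hs.1
    have := le_max_right (f a) 0
    linarith
  · push Not at hz
    have h1 := sub_le_mul_sub_of_deriv_le_off_finite (c := c) hC hab hf fun t ht htC =>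
      h t ht htC (hz t (Ioo_subset_Icc_self ht))
    have := le_max_left (f a) 0
    linarith

/-! ### Parameter derivatives from comparison of increments. -/

section FDeriv

variable {E : Type*} [NormedAddCommGroup E] [NormedSpace ℝ E]

/-- A one-sided bound on increments bounds the derivative on both sides. -/
theorem norm_fderiv_le_of_sub_le {f g : E → ℝ} {f' : E →L[ℝ] ℝ} {x₀ : E} {C : ℝ} (hC : 0 ≤ C)
    (hf : HasFDerivAt f f' x₀) (hg : HasFDerivAt g (0 : E →L[ℝ] ℝ) x₀)
    (h : ∀ᶠ x in 𝓝 x₀, f x - f x₀ ≤ g x - g x₀ + C * ‖x - x₀‖) : ‖f'‖ ≤ C := by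
  have key : ∀ v, f' v ≤ C * ‖v‖ := by
    intro v
    have hk : HasFDerivAt (fun x => f x - g x) f' x₀ := by
      have := hf.sub hg
      rwa [sub_zero] at this
    have h1 := (hk.hasLineDerivAt v).tendsto_slope_zero_right
    refine le_of_tendsto h1 ?_
    have h2 : Tendsto (fun t : ℝ => x₀ + t • v) (𝓝[>] 0) (𝓝 x₀) := by
      have : Continuous (fun t : ℝ => x₀ + t • v) := by fun_prop
      have h3 := this.tendsto 0
      rw [zero_smul, add_zero] at h3
      exact h3.mono_left nhdsWithin_le_nhds
    filter_upwards [h2.eventually h, self_mem_nhdsWithin] with t ht ht0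
    have ht0 : 0 < t := ht0
    simp only [add_sub_cancel_left, norm_smul, Real.norm_eq_abs, abs_of_pos ht0,
      smul_eq_mul] at ht ⊢
    rw [inv_mul_le_iff₀ ht0]
    linarith
  refine f'.opNorm_le_bound hC fun v => ?_
  rw [Real.norm_eq_abs, abs_le]
  -- Linearity turns the upper bound in direction `-v` into the lower bound in direction `v`.
  have := key (-v)
  simp only [map_neg, norm_neg] at this
  exact ⟨by linarith, key v⟩

theorem fderiv_eq_of_sub_eq {f g : E → ℝ} {x₀ : E}
    (h : ∀ᶠ x in 𝓝 x₀, f x - f x₀ = g x - g x₀) : fderiv ℝ f x₀ = fderiv ℝ g x₀ := by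
  have h1 : f =ᶠ[𝓝 x₀] fun x => g x + (f x₀ - g x₀) := by
    filter_upwards [h] with x hx
    linarith
  rw [h1.fderiv_eq, fderiv_add_const]

end FDeriv

/-! ### Propagation of the value zero along the time interval. -/

theorem eventually_notMem_nhdsNE {B : Set ℝ} (hB : B.Finite) (τ : ℝ) : ∀ᶠ u in 𝓝[≠] τ, u ∉ B := by
  have h : (B \ {τ})ᶜ ∈ 𝓝 τ := (hB.subset sdiff_subset).isClosed.isOpen_compl.mem_nhds (by simp)
  filter_upwards [nhdsWithin_le_nhds h, self_mem_nhdsWithin] with u hu hne hB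
  exact hu ⟨hB, hne⟩

theorem eventually_notMem_nhdsGT {B : Set ℝ} (hB : B.Finite) (τ : ℝ) : ∀ᶠ u in 𝓝[>] τ, u ∉ B :=
  (eventually_notMem_nhdsNE hB τ).filter_mono (nhdsWithin_mono _ fun _ h => ne_of_gt h)

theorem eventually_notMem_nhdsLT {B : Set ℝ} (hB : B.Finite) (τ : ℝ) : ∀ᶠ u in 𝓝[<] τ, u ∉ B :=
  (eventually_notMem_nhdsNE hB τ).filter_mono (nhdsWithin_mono _ fun _ h => ne_of_lt h)

theorem eq_of_locally_eq_on_Ioo {α : Type*} {f : ℝ → α} {a b : ℝ}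
    (h : ∀ s ∈ Ioo a b, ∀ᶠ u in 𝓝 s, f u = f s) {s t : ℝ} (hs : s ∈ Ioo a b) (ht : t ∈ Ioo a b) :
    f s = f t :=
  isPreconnected_Ioo.induction₂ (fun u v => f u = f v)
    (fun u hu => ((h u hu).filter_mono nhdsWithin_le_nhds).mono fun _ hv => hv.symm)
    (fun _ _ _ _ _ _ => Eq.trans) (fun _ _ _ _ => Eq.symm) hs ht

theorem Icc_mem_nhdsGT_of_lt {T τ : ℝ} (h0 : 0 ≤ τ) (hT : τ < T) : Icc 0 T ∈ 𝓝[>] τ := by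
  filter_upwards [Ioo_mem_nhdsGT hT] with s hs
  exact ⟨h0.trans hs.1.le, hs.2.le⟩

theorem Icc_mem_nhdsLT_of_lt {T τ : ℝ} (h0 : 0 < τ) (hT : τ ≤ T) : Icc 0 T ∈ 𝓝[<] τ := by
  filter_upwards [Ioo_mem_nhdsLT h0] with s hs
  exact ⟨hs.1.le, hs.2.le.trans hT⟩

/-- A function that is locally constant off a finite set `B` and whose value zero propagates to
the right across the points of `B` vanishes off `B`. -/
theorem eq_zero_of_propagates {E : Type*} [NormedAddCommGroup E] {T : ℝ} {B : Set ℝ}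
    (hB : B.Finite) {Δ : ℝ → E} (h0 : Δ 0 = 0)
    (h1 : ∀ τ ∈ Icc 0 T, τ ∉ B → ∀ᶠ v in 𝓝[Icc 0 T] τ, Δ v = Δ τ)
    (h2 : ∀ τ ∈ Ico 0 T, τ ∈ B → (∀ u ∈ Ico 0 τ, u ∉ B → Δ u = 0) →
      ∀ ε > 0, ∀ᶠ v in 𝓝[>] τ, v ∉ B → ‖Δ v‖ ≤ ε) :
    ∀ t ∈ Icc 0 T, t ∉ B → Δ t = 0 := by
  intro t ht htB
  set A : Set ℝ := {s | ∀ u ∈ Icc 0 s, u ∉ B → Δ u = 0} with hA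
  have hloc : ∀ s ∈ Ioo 0 T, s ∉ B → ∀ᶠ v in 𝓝 s, Δ v = Δ s := fun s hs hsB => by
    have := h1 s (Ioo_subset_Icc_self hs) hsB
    rwa [nhdsWithin_eq_nhds.2 (Icc_mem_nhds hs.1 hs.2)] at this
  -- extension to the right of a point before which `Δ` vanishes
  have hstep : ∀ s ∈ Icc 0 T, (∀ u ∈ Ico 0 s, u ∉ B → Δ u = 0) →
      (s ∉ B → Δ s = 0) ∧ (s < T → ∀ᶠ v in 𝓝[>] s, v ∉ B → Δ v = 0) := by
    intro s hs hbef
    by_cases hsB : s ∈ B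
    · refine ⟨fun h => absurd hsB h, fun hsT => ?_⟩
      -- `Δ` is constant on a gap to the right of `s` free of `B`; norms below every `ε` arbitrarily
      -- close to `s` force this constant to be 0.
      obtain ⟨b, hb, hbB⟩ := (mem_nhdsGT_iff_exists_Ioo_subset' hsT).1
        ((eventually_notMem_nhdsGT hB s).and (Ioo_mem_nhdsGT hsT))
      filter_upwards [Ioo_mem_nhdsGT hb] with v hv _
      refine norm_le_zero_iff.1 (le_of_forall_gt_imp_ge_of_dense fun ε hε => ?_)
      obtain ⟨v', hv'1, hv'2⟩ := ((h2 s ⟨hs.1, hsT⟩ hsB hbef ε hε).and (Ioo_mem_nhdsGT hb)).exists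
      rw [eq_of_locally_eq_on_Ioo (f := Δ) (fun u hu => hloc u
        ⟨hs.1.trans_lt hu.1, (hbB hu).2.2⟩ (hbB hu).1) hv hv'2]
      exact hv'1 (hbB hv'2).1
    · have hs0 : Δ s = 0 := by
        rcases hs.1.eq_or_lt with rfl | hpos
        · exact h0
        have h3 : ∀ᶠ v in 𝓝[<] s, Δ v = Δ s :=
          (h1 s hs hsB).filter_mono (le_inf nhdsWithin_le_nhds
            (le_principal_iff.2 (Icc_mem_nhdsLT_of_lt hpos hs.2)))
        obtain ⟨v, hv1, hv2, hv3⟩ :=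
          (h3.and ((eventually_notMem_nhdsLT hB s).and (Ioo_mem_nhdsLT hpos))).exists
        rw [← hv1]
        exact hbef v ⟨hv3.1.le, hv3.2⟩ hv2
      refine ⟨fun _ => hs0, fun hsT => ?_⟩
      have h3 : ∀ᶠ v in 𝓝[>] s, Δ v = Δ s :=
          (h1 s hs hsB).filter_mono (le_inf nhdsWithin_le_nhds
            (le_principal_iff.2 (Icc_mem_nhdsGT_of_lt hs.1 hsT)))
      filter_upwards [h3] with v hv _
      rw [hv, hs0]
  have hT0 : 0 ≤ T := ht.1.trans ht.2
  -- Continuous induction: if the longest initial segment on which `Δ` vanishes off `B` ended before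
  -- `T`, `hstep` would extend it.
  set s := sSup (A ∩ Icc 0 T) with hsdef
  have hbdd : BddAbove (A ∩ Icc 0 T) := ⟨T, fun u hu => hu.2.2⟩
  have hne : (A ∩ Icc 0 T).Nonempty := ⟨0, fun u hu _ => by
    rw [le_antisymm hu.2 hu.1, h0], left_mem_Icc.2 hT0⟩
  have hs : s ∈ Icc 0 T := ⟨by
    obtain ⟨u, hu⟩ := hne
    exact hu.2.1.trans (le_csSup hbdd hu), csSup_le hne fun u hu => hu.2.2⟩
  have hbef : ∀ u ∈ Ico 0 s, u ∉ B → Δ u = 0 := fun u hu huB => by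
    obtain ⟨v, hv, huv⟩ := exists_lt_of_lt_csSup hne hu.2
    exact hv.1 u ⟨hu.1, huv.le⟩ huB
  obtain ⟨hs1, hs2⟩ := hstep s hs hbef
  rcases hs.2.eq_or_lt with hsT | hsT
  · rcases ht.2.eq_or_lt with h | h
    · rw [h, ← hsT]; exact hs1 (by rwa [hsT, ← h])
    · exact hbef t ⟨ht.1, hsT ▸ h⟩ htB
  · exfalso
    obtain ⟨b, hb, hbB⟩ := (mem_nhdsGT_iff_exists_Ioo_subset' hsT).1
      ((hs2 hsT).and (Ioo_mem_nhdsGT hsT))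
    obtain ⟨v, hv⟩ := exists_between (show s < b from hb)
    have : v ∈ A ∩ Icc 0 T := by
      refine ⟨fun u hu huB => ?_, hs.1.trans hv.1.le, (hbB hv).2.2.le⟩
      rcases lt_trichotomy u s with h | h | h
      · exact hbef u ⟨hu.1, h⟩ huB
      · subst h; exact hs1 huB
      · exact (hbB ⟨h, hu.2.trans_lt hv.2⟩).1 huB
    exact absurd (le_csSup hbdd this) (not_le.2 hv.1)

end DataHarvesting

/-! ### Zero sets of non-negative functions with finitely many hits. -/

namespace DataHarvesting

section ZeroSets

variable {T : ℝ} {h : ℝ → ℝ}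

theorem exists_hitsZero_of_pos_of_nonpos (hc : ContinuousOn h (Icc 0 T))
    (hn : ∀ t ∈ Icc 0 T, 0 ≤ h t) {s t : ℝ} (hs : 0 ≤ s) (ht : t ≤ T) (hst : s ≤ t)
    (hpos : 0 < h s) (hz : h t ≤ 0) : ∃ τ ∈ Ioc s t, HitsZero T h τ := by
  obtain ⟨τ, hτ, h0, hbef⟩ := exists_first_nonpos (hc.mono (Icc_subset_Icc hs ht)) hpos
    ⟨t, right_mem_Icc.2 hst, hz⟩
  refine ⟨τ, hτ, hs.trans_lt hτ.1, hτ.2.trans ht, le_antisymm h0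
    (hn τ ⟨hs.trans hτ.1.le, hτ.2.trans ht⟩), ?_⟩
  filter_upwards [Ioo_mem_nhdsLT hτ.1] with u hu
  exact hbef u ⟨hu.1.le, hu.2⟩

/-- To the right of any time, a function with finitely many hits is either zero or positive. -/
theorem eventually_zero_or_pos_nhdsGT (hc : ContinuousOn h (Icc 0 T))
    (hn : ∀ t ∈ Icc 0 T, 0 ≤ h t) (hfin : {τ | HitsZero T h τ}.Finite) {τ : ℝ}
    (hτ : τ ∈ Ico 0 T) : (∀ᶠ u in 𝓝[>] τ, h u = 0) ∨ ∀ᶠ u in 𝓝[>] τ, 0 < h u := by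
  obtain ⟨b, hb, hbB⟩ := (mem_nhdsGT_iff_exists_Ioo_subset' hτ.2).1
    ((eventually_notMem_nhdsGT hfin τ).and (Ioo_mem_nhdsGT hτ.2))
  -- In a gap free of hits, a zero at `u` forces zeros all the way back to `τ`.
  by_cases hz : ∃ u ∈ Ioo τ b, h u = 0
  · left
    obtain ⟨u, hu, hu0⟩ := hz
    filter_upwards [Ioo_mem_nhdsGT hu.1] with s hs
    by_contra hne
    have hsI : s ∈ Icc 0 T := ⟨hτ.1.trans hs.1.le, (hs.2.trans (hbB hu).2.2).le⟩
    obtain ⟨τ', hτ', hhit⟩ := exists_hitsZero_of_pos_of_nonpos hc hn hsI.1 (hbB hu).2.2.le hs.2.le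
      ((hn s hsI).lt_of_ne' hne) hu0.le
    exact (hbB ⟨hs.1.trans hτ'.1, hτ'.2.trans_lt hu.2⟩).1 hhit
  · right
    push Not at hz
    filter_upwards [Ioo_mem_nhdsGT hb] with u hu
    exact (hn u ⟨hτ.1.trans hu.1.le, (hbB hu).2.2.le⟩).lt_of_ne' (hz u hu)

theorem eventually_zero_or_pos_nhdsLT (hc : ContinuousOn h (Icc 0 T))
    (hn : ∀ t ∈ Icc 0 T, 0 ≤ h t) (hfin : {τ | HitsZero T h τ}.Finite) {τ : ℝ}
    (hτ : τ ∈ Ioc 0 T) : (∀ᶠ u in 𝓝[<] τ, h u = 0) ∨ ∀ᶠ u in 𝓝[<] τ, 0 < h u := by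
  obtain ⟨b, hb, hbB⟩ := (mem_nhdsLT_iff_exists_Ioo_subset' hτ.1).1
    ((eventually_notMem_nhdsLT hfin τ).and (Ioo_mem_nhdsLT hτ.1))
  by_cases hz : ∃ u ∈ Ioo b τ, 0 < h u
  · right
    obtain ⟨u, hu, hu0⟩ := hz
    filter_upwards [Ioo_mem_nhdsLT hu.2] with s hs
    by_contra! hne
    obtain ⟨τ', hτ', hhit⟩ := exists_hitsZero_of_pos_of_nonpos hc hn (hbB hu).2.1.le
      (hs.2.le.trans hτ.2) hs.1.le hu0 hne
    exact (hbB ⟨hu.1.trans hτ'.1, hτ'.2.trans_lt hs.2⟩).1 hhit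
  · left
    push Not at hz
    filter_upwards [Ioo_mem_nhdsLT hb] with u hu
    exact le_antisymm (hz u hu) (hn u ⟨(hbB hu).2.1.le, hu.2.le.trans hτ.2⟩)

theorem nhdsWithin_Icc_le_sup {T τ : ℝ} :
    𝓝[Icc 0 T] τ ≤ pure τ ⊔ 𝓝[Icc 0 T ∩ Iio τ] τ ⊔ 𝓝[Icc 0 T ∩ Ioi τ] τ := by
  rw [← nhdsWithin_singleton, ← nhdsWithin_union, ← nhdsWithin_union]
  refine nhdsWithin_mono _ fun s hs => ?_
  rcases lt_trichotomy s τ with h | h | h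
  · exact Or.inl (Or.inr ⟨hs, h⟩)
  · exact Or.inl (Or.inl h)
  · exact Or.inr ⟨hs, h⟩

/-- A property that holds at `τ` and on both sides of `τ`, as far as they lie in `[0, T]`. -/
theorem eventually_nhdsWithin_Icc {p : ℝ → Prop} {T τ : ℝ} (hτ : τ ∈ Icc 0 T) (h0 : p τ)
    (hl : 0 < τ → ∀ᶠ u in 𝓝[<] τ, p u) (hr : τ < T → ∀ᶠ u in 𝓝[>] τ, p u) :
    ∀ᶠ u in 𝓝[Icc 0 T] τ, p u := by
  refine Filter.Eventually.filter_mono nhdsWithin_Icc_le_sup (eventually_sup.2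
    ⟨eventually_sup.2 ⟨h0, ?_⟩, ?_⟩)
  · rcases hτ.1.eq_or_lt with h | h
    · subst h
      have : Icc 0 T ∩ Iio 0 = ∅ := by ext s; simp only [mem_inter_iff, mem_Icc, mem_Iio,
        mem_empty_iff_false, iff_false]; intro ⟨h1, h2⟩; linarith
      simp [this]
    · exact (hl h).filter_mono (nhdsWithin_mono _ inter_subset_right)
  · rcases hτ.2.eq_or_lt with h | h
    · subst h
      have : Icc 0 τ ∩ Ioi τ = ∅ := by ext s; simp only [mem_inter_iff, mem_Icc, mem_Ioi,
        mem_empty_iff_false, iff_false]; intro ⟨h1, h2⟩; linarith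
      simp [this]
    · exact (hr h).filter_mono (nhdsWithin_mono _ inter_subset_right)

/-- Near a zero that is neither hit nor left, the function vanishes. -/
theorem eventually_zero_of_not_hits_of_not_leaves (hc : ContinuousOn h (Icc 0 T))
    (hn : ∀ t ∈ Icc 0 T, 0 ≤ h t) (hfin : {τ | HitsZero T h τ}.Finite) {τ : ℝ}
    (hτ : τ ∈ Icc 0 T) (h0 : h τ = 0) (hh : ¬ HitsZero T h τ) (hl : ¬ LeavesZero T h τ) :
    ∀ᶠ u in 𝓝[Icc 0 T] τ, h u = 0 := by
  refine eventually_nhdsWithin_Icc hτ h0 (fun hp => ?_) fun hp => ?_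
  · exact (eventually_zero_or_pos_nhdsLT hc hn hfin ⟨hp, hτ.2⟩).resolve_right
      fun h' => hh ⟨hp, hτ.2, h0, h'⟩
  · exact (eventually_zero_or_pos_nhdsGT hc hn hfin ⟨hτ.1, hp⟩).resolve_right
      fun hpos => hl ⟨hτ.1, hp, h0, hpos⟩

/-- Two functions with the same initial sign and the same hits, such that the second leaves zero
or is already positive when the first one leaves zero, have the same positivity. -/
theorem pos_of_pos_of_hits {h₁ h₂ : ℝ → ℝ}
    (hc₁ : ContinuousOn h₁ (Icc 0 T)) (hn₁ : ∀ t ∈ Icc 0 T, 0 ≤ h₁ t)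
    (hc₂ : ContinuousOn h₂ (Icc 0 T)) (hn₂ : ∀ t ∈ Icc 0 T, 0 ≤ h₂ t)
    (h0 : 0 < h₁ 0 → 0 < h₂ 0)
    (hhit : ∀ τ, HitsZero T h₂ τ → HitsZero T h₁ τ)
    (hleave : ∀ τ, LeavesZero T h₁ τ → ∀ᶠ u in 𝓝[>] τ, 0 < h₂ u)
    {t : ℝ} (ht : t ∈ Icc 0 T) (hpos : 0 < h₁ t) : 0 < h₂ t := by
  by_contra! hz
  have hc : ContinuousOn h₁ (Icc 0 t) := hc₁.mono (Icc_subset_Icc_right ht.2)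
  by_cases hex : ∃ s ∈ Icc 0 t, h₁ s ≤ 0
  -- `h₁` leaves 0 at `ζ`, so `h₂` is positive just after. If `h₂` vanished at `t` it would hit 0
  -- after `ζ`, and then `h₁` would hit 0 where it is positive.
  · obtain ⟨ζ, hζ, hζ0, hafter⟩ := exists_last_nonpos hc hpos hex
    have hleft : LeavesZero T h₁ ζ := by
      refine ⟨hζ.1, hζ.2.trans_le ht.2, le_antisymm hζ0 (hn₁ ζ ⟨hζ.1, hζ.2.le.trans ht.2⟩), ?_⟩
      filter_upwards [Ioo_mem_nhdsGT hζ.2] with u hu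
      exact hafter u ⟨hu.1, hu.2.le⟩
    obtain ⟨s, hs1, hs2⟩ := ((hleave ζ hleft).and (Ioo_mem_nhdsGT hζ.2)).exists
    obtain ⟨τ, hτ, hτh⟩ := exists_hitsZero_of_pos_of_nonpos hc₂ hn₂ (hζ.1.trans hs2.1.le) ht.2
      hs2.2.le hs1 hz
    exact (hafter τ ⟨hs2.1.trans hτ.1, hτ.2⟩).ne' (hhit τ hτh).2.2.1
  · push Not at hex
    obtain ⟨τ, hτ, hτh⟩ := exists_hitsZero_of_pos_of_nonpos hc₂ hn₂ le_rfl ht.2 ht.1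
      (h0 (hex 0 (left_mem_Icc.2 ht.1))) hz
    exact (hex τ ⟨hτ.1.le, hτ.2⟩).ne' (hhit τ hτh).2.2.1

end ZeroSets

/-- By compactness, local bounds from the one-sided limits suffice. The bound on arrivals makes
target queues Lipschitz in time, uniformly in the parameter. -/
theorem PiecewiseContinuous.exists_bound {T : ℝ} {h : ℝ → ℝ} (hh : PiecewiseContinuous T h) :
    ∃ C, ∀ t ∈ Icc 0 T, h t ≤ C := by
  have hb : BddAbove (h '' (Icc 0 T ∩ Icc 0 T)) := by
    refine isCompact_Icc.induction_on (s := Icc 0 T) (p := fun s => BddAbove (h '' (s ∩ Icc 0 T))) (by simp)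
      (fun s t hst ht => ht.mono (image_mono (inter_subset_inter_left _ hst)))
      (fun s t hs ht => by rw [union_inter_distrib_right, image_union]; exact hs.union ht)
      (fun x hx => ?_)
    obtain ⟨⟨l₁, h₁⟩, l₂, h₂⟩ := hh.2 x hx
    have key : ∀ᶠ u in 𝓝[Icc 0 T] x, h u ≤ max (h x) (max (l₁ + 1) (l₂ + 1)) := by
      refine Filter.Eventually.filter_mono nhdsWithin_Icc_le_sup (eventually_sup.2
        ⟨eventually_sup.2 ⟨eventually_pure.2 (le_max_left _ _), ?_⟩, ?_⟩)
      · filter_upwards [h₁.eventually_lt_const (lt_add_one l₁)] with u hu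
        exact hu.le.trans ((le_max_left _ _).trans (le_max_right _ _))
      · filter_upwards [h₂.eventually_lt_const (lt_add_one l₂)] with u hu
        exact hu.le.trans ((le_max_right _ _).trans (le_max_right _ _))
    refine ⟨_, key, ⟨max (h x) (max (l₁ + 1) (l₂ + 1)), ?_⟩⟩
    rintro _ ⟨u, ⟨hu, -⟩, rfl⟩
    exact hu
  rw [inter_self] at hb
  obtain ⟨C, hC⟩ := hb
  exact ⟨C, fun t ht => hC (mem_image_of_mem _ ht)⟩

/-- Makes the set of all event times finite, as a finite union. -/
instance finite_event (M N : ℕ) : Finite (Event M N) := by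
  refine Finite.of_surjective (α := (Fin M ⊕ Fin M) ⊕ ((Fin M × Fin N) ⊕ (Fin M × Fin N)) ⊕
    ((Fin M × Fin N) ⊕ (Fin M × Fin N)) ⊕ (Fin N ⊕ Fin N))
    (Sum.elim (Sum.elim .xiZero .xiPlus) <| Sum.elim
      (Sum.elim (fun q => .zetaZero q.1 q.2) fun q => .zetaPlus q.1 q.2) <| Sum.elim
      (Sum.elim (fun q => .deltaPlus q.1 q.2) fun q => .deltaZero q.1 q.2) <|
      Sum.elim .basePlus .baseZero) ?_
  rintro (i | i | ⟨i, j⟩ | ⟨i, j⟩ | ⟨i, j⟩ | ⟨i, j⟩ | j | j)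
  exacts [⟨.inl (.inl i), rfl⟩, ⟨.inl (.inr i), rfl⟩, ⟨.inr (.inl (.inl (i, j))), rfl⟩,
    ⟨.inr (.inl (.inr (i, j))), rfl⟩, ⟨.inr (.inr (.inl (.inl (i, j)))), rfl⟩,
    ⟨.inr (.inr (.inl (.inr (i, j)))), rfl⟩, ⟨.inr (.inr (.inr (.inl j))), rfl⟩,
    ⟨.inr (.inr (.inr (.inr j))), rfl⟩]

end DataHarvesting

/-! ### Collection and delivery rates, and their regularity near the observed parameter. -/

namespace DataHarvesting

namespace Setting

variable {M N : ℕ} {d : Fin N → ℕ} (S : Setting M N d)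

/-- `μ̃_ij P_ij`, the rate at which agent `j` collects from target `i`. -/
noncomputable def inflow (i : Fin M) (j : Fin N) (Θ : Params d) (t a x : ℝ) : ℝ :=
  S.muTilde i j Θ t a x * S.P i j Θ t

/-- `β_ij P_Bj 1[Z_ij > 0]`, the rate at which agent `j` delivers data of target `i`. -/
noncomputable def outflow (i : Fin M) (j : Fin N) (Θ : Params d) (t z : ℝ) : ℝ :=
  if 0 < z then S.β i j * S.PB j Θ t else 0

variable {S} {T : ℝ} {F : Set (Params d)} {Θ₀ : Params d}

theorem inflow_of_conn_ne {i : Fin M} {j : Fin N} {Θ : Params d} {t a x : ℝ}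
    (h : S.conn Θ t i ≠ some j) : S.inflow i j Θ t a x = 0 := by
  simp [inflow, muTilde, h]

theorem drain_of_conn_eq {i : Fin M} {j : Fin N} {Θ : Params d} {t : ℝ}
    (h : S.conn Θ t i = some j) : S.drain i Θ t = S.μ i j * S.P i j Θ t := by
  simp [drain, h]

theorem drain_of_conn_none {i : Fin M} {Θ : Params d} {t : ℝ}
    (h : S.conn Θ t i = none) : S.drain i Θ t = 0 := by
  simp [drain, h]

theorem Xdot_of_pos {i : Fin M} {Θ : Params d} {t a x : ℝ} (hx : 0 < x) :
    S.Xdot i Θ t a x = a - S.drain i Θ t := by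
  simp [Xdot, hx.ne']

theorem sub_drain_le_Xdot (i : Fin M) (Θ : Params d) (t a x : ℝ) :
    a - S.drain i Θ t ≤ S.Xdot i Θ t a x := by
  unfold Xdot
  split_ifs with h
  · linarith [h.2]
  · exact le_rfl

/-- Positive contents of the target queue make the collection rate independent of arrivals. -/
theorem inflow_eq_of_pos {i : Fin M} {j : Fin N} {Θ : Params d} {t a₁ a₂ x₁ x₂ : ℝ}
    (h₁ : 0 < x₁) (h₂ : 0 < x₂) : S.inflow i j Θ t a₁ x₁ = S.inflow i j Θ t a₂ x₂ := by
  simp [inflow, muTilde, h₁.ne', h₂.ne']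

namespace Admissible

variable (hS : S.Admissible T F Θ₀)
include hS

/-- A non-increasing function that vanishes far out is non-negative. -/
theorem p_nonneg (i : Fin M) (j : Fin N) {x : ℝ} (hx : 0 ≤ x) : 0 ≤ S.p i j x := by
  have h1 : x ≤ max x (S.r i j + 1) := le_max_left _ _
  rw [← hS.p_zero i j (max x (S.r i j + 1)) (hx.trans h1)
    ((lt_add_one _).trans_le (le_max_right _ _))]
  exact hS.p_anti i j hx (hx.trans h1) h1

theorem pB_nonneg (j : Fin N) {x : ℝ} (hx : 0 ≤ x) : 0 ≤ S.pB j x := by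
  have h1 : x ≤ max x (S.rB j + 1) := le_max_left _ _
  rw [← hS.pB_zero j (max x (S.rB j + 1)) (hx.trans h1)
    ((lt_add_one _).trans_le (le_max_right _ _))]
  exact hS.pB_anti j hx (hx.trans h1) h1

theorem P_nonneg (i : Fin M) (j : Fin N) (Θ : Params d) (t : ℝ) : 0 ≤ S.P i j Θ t :=
  hS.p_nonneg i j dist_nonneg

theorem PB_nonneg (j : Fin N) (Θ : Params d) (t : ℝ) : 0 ≤ S.PB j Θ t :=
  hS.pB_nonneg j dist_nonneg

theorem P_le (i : Fin M) (j : Fin N) (Θ : Params d) (t : ℝ) : S.P i j Θ t ≤ S.p i j 0 :=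
  hS.p_anti i j (mem_Ici.2 le_rfl) (mem_Ici.2 dist_nonneg) dist_nonneg

theorem PB_le (j : Fin N) (Θ : Params d) (t : ℝ) : S.PB j Θ t ≤ S.pB j 0 :=
  hS.pB_anti j (mem_Ici.2 le_rfl) (mem_Ici.2 dist_nonneg) dist_nonneg

theorem P_eq_zero {i : Fin M} {j : Fin N} {Θ : Params d} {t : ℝ} (h : S.r i j < S.D i j Θ t) :
    S.P i j Θ t = 0 :=
  hS.p_zero i j _ dist_nonneg h

/-- The triangle inequality against the separation of target and base. Collection and delivery
therefore never mix, even at the boundary of the range. -/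
theorem rB_lt_DB {i : Fin M} {j : Fin N} {Θ : Params d} {t : ℝ} (h : S.D i j Θ t ≤ S.r i j) :
    S.rB j < S.DB j Θ t := by
  have h1 := hS.separated i j
  have h2 : dist (S.w i) S.wB ≤ S.D i j Θ t + S.DB j Θ t := by
    unfold D DB
    rw [dist_comm S.wB]
    exact dist_triangle _ _ _
  linarith

theorem PB_eq_zero {j : Fin N} {Θ : Params d} {t : ℝ} (h : S.rB j < S.DB j Θ t) :
    S.PB j Θ t = 0 :=
  hS.pB_zero j _ dist_nonneg h

theorem conn_ne_of_lt {i : Fin M} {j : Fin N} {Θ : Params d} {t : ℝ} (hΘ : Θ ∈ F)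
    (ht : t ∈ Icc 0 T) (h : S.r i j < S.D i j Θ t) : S.conn Θ t i ≠ some j := fun h' =>
  absurd (hS.conn_range Θ hΘ t ht i j h') (not_le.2 h)

theorem drain_nonneg (i : Fin M) (Θ : Params d) (t : ℝ) : 0 ≤ S.drain i Θ t := by
  rcases hc : S.conn Θ t i with _ | j
  · rw [drain_of_conn_none hc]
  · rw [drain_of_conn_eq hc]
    exact mul_nonneg (hS.μ_nonneg i j) (hS.P_nonneg i j Θ t)

/-- For an empty queue, `min a (μP)` and the growth `max 0 (a - μP)` add up to `a`. If `P = 0`, the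
effective rate is `μ` by convention, but both sides vanish because `0 ≤ a`. -/
theorem inflow_of_conn_eq {i : Fin M} {j : Fin N} {Θ : Params d} {t a x : ℝ}
    (h : S.conn Θ t i = some j) (ha : 0 ≤ a) :
    S.inflow i j Θ t a x = a - S.Xdot i Θ t a x := by
  have hμ := hS.μ_nonneg i j
  have hP := hS.P_nonneg i j Θ t
  simp only [inflow, muTilde, Xdot, drain_of_conn_eq h, h, if_true]
  rcases hP.eq_or_lt with hP0 | hP0
  · simp only [← hP0, mul_zero]
    split_ifs with h1
    · linarith [h1.2]
    · simp
  · by_cases hx : x = 0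
    · simp only [hx, hP0, and_self, if_true, true_and]
      rw [min_mul_of_nonneg _ _ hP, div_mul_cancel₀ _ hP0.ne']
      split_ifs with h1
      · rw [min_eq_left h1, sub_zero]
      · rw [min_eq_right (not_le.1 h1).le]
        ring
    · simp [hx]

theorem inflow_nonneg {i : Fin M} {j : Fin N} {Θ : Params d} {t a x : ℝ} (ha : 0 ≤ a) :
    0 ≤ S.inflow i j Θ t a x := by
  refine mul_nonneg ?_ (hS.P_nonneg i j Θ t)
  unfold muTilde
  have := hS.μ_nonneg i j
  split_ifs with h1 h2
  · exact le_min (div_nonneg ha h2.2.le) this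
  · exact this
  · exact le_rfl

theorem inflow_le {i : Fin M} {j : Fin N} {Θ : Params d} {t a x : ℝ} :
    S.inflow i j Θ t a x ≤ S.μ i j * S.P i j Θ t := by
  refine mul_le_mul_of_nonneg_right ?_ (hS.P_nonneg i j Θ t)
  unfold muTilde
  split_ifs with h1 h2
  · exact min_le_right _ _
  · exact le_rfl
  · exact hS.μ_nonneg i j

theorem Xdot_le {i : Fin M} {Θ : Params d} {t a x : ℝ} (ha : 0 ≤ a) :
    S.Xdot i Θ t a x ≤ a := by
  have := hS.drain_nonneg i Θ t
  unfold Xdot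
  split_ifs <;> linarith

/-- What the target queue loses is collected by the agents of any set that contains the
connected one. -/
theorem sum_inflow {i : Fin M} {Θ : Params d} {t a x : ℝ} (ha : 0 ≤ a)
    {A : Finset (Fin N)} (hA : ∀ j, S.conn Θ t i = some j → j ∈ A) :
    ∑ j ∈ A, S.inflow i j Θ t a x = a - S.Xdot i Θ t a x := by
  rcases hc : S.conn Θ t i with _ | j
  · rw [Finset.sum_eq_zero fun j _ => inflow_of_conn_ne (by simp [hc])]
    simp only [Xdot, drain_of_conn_none hc]
    split_ifs with h
    · linarith [h.2]
    · ring
  · rw [Finset.sum_eq_single_of_mem j (hA j hc) fun l _ hl => inflow_of_conn_ne (by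
      rw [hc]; simpa using hl.symm)]
    exact hS.inflow_of_conn_eq hc ha

theorem inflow_le_sub_Xdot {i : Fin M} {j : Fin N} {Θ : Params d} {t a x : ℝ} (ha : 0 ≤ a) : S.inflow i j Θ t a x ≤ a - S.Xdot i Θ t a x := by
  by_cases h : S.conn Θ t i = some j
  · exact (hS.inflow_of_conn_eq h ha).le
  · rw [inflow_of_conn_ne h]
    linarith [hS.Xdot_le (i := i) (Θ := Θ) (t := t) (x := x) ha]

theorem outflow_nonneg {i : Fin M} {j : Fin N} {Θ : Params d} {t z : ℝ} :
    0 ≤ S.outflow i j Θ t z := by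
  unfold outflow
  split_ifs
  · exact mul_nonneg (hS.β_nonneg i j) (hS.PB_nonneg j Θ t)
  · exact le_rfl

theorem outflow_le {i : Fin M} {j : Fin N} {Θ : Params d} {t z : ℝ} :
    S.outflow i j Θ t z ≤ S.β i j * S.pB j 0 := by
  have h := mul_le_mul_of_nonneg_left (hS.PB_le j Θ t) (hS.β_nonneg i j)
  have h' := mul_nonneg (hS.β_nonneg i j) (hS.PB_nonneg j Θ t)
  unfold outflow
  split_ifs
  · exact h
  · exact h'.trans h

/-- At `z = 0` the truncation just switches delivery off: a connected agent is out of reach of the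
base, so its net flow is its inflow; an unconnected one has non-positive net flow, which is cut to
0. -/
theorem Zdot_eq {i : Fin M} {j : Fin N} {Θ : Params d} {t a x z : ℝ} (hΘ : Θ ∈ F)
    (ht : t ∈ Icc 0 T) (ha : 0 ≤ a) (hz : 0 ≤ z) :
    S.Zdot i j Θ t a x z = S.inflow i j Θ t a x - S.outflow i j Θ t z := by
  have hin := hS.inflow_nonneg (i := i) (j := j) (Θ := Θ) (t := t) (x := x) ha
  change (if z = 0 ∧ S.inflow i j Θ t a x - S.β i j * S.PB j Θ t ≤ 0 then 0
    else S.inflow i j Θ t a x - S.β i j * S.PB j Θ t) = _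
  unfold outflow
  rcases hz.eq_or_lt with rfl | hz
  · simp only [true_and, lt_irrefl, if_false, sub_zero]
    by_cases hc : S.conn Θ t i = some j
    · rw [hS.PB_eq_zero (hS.rB_lt_DB (hS.conn_range Θ hΘ t ht i j hc)), mul_zero, sub_zero]
      split_ifs with h
      · exact le_antisymm hin h
      · rfl
    · rw [inflow_of_conn_ne hc, if_pos]
      have := mul_nonneg (hS.β_nonneg i j) (hS.PB_nonneg j Θ t)
      linarith
  · simp [hz, hz.ne']

end Admissible

/-- The dynamics, with collection and delivery separated. -/
theorem IsStatePath.exists_finite_hasDerivAt {Θ : Params d} {a x : Fin M → ℝ → ℝ}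
    {z : Fin M → Fin N → ℝ → ℝ} {y : Fin M → ℝ → ℝ} (h : S.IsStatePath T Θ a x z y)
    (hS : S.Admissible T F Θ₀) (hΘ : Θ ∈ F) (ha : ∀ i, ∀ t ∈ Icc 0 T, 0 ≤ a i t) :
    ∃ C : Set ℝ, C.Finite ∧ ∀ t ∈ Ioo 0 T, t ∉ C →
      (∀ i, HasDerivAt (x i) (S.Xdot i Θ t (a i t) (x i t)) t) ∧
      (∀ i j, HasDerivAt (z i j)
        (S.inflow i j Θ t (a i t) (x i t) - S.outflow i j Θ t (z i j t)) t) ∧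
      ∀ i, HasDerivAt (y i) (∑ j, S.outflow i j Θ t (z i j t)) t := by
  obtain ⟨C, hC, h'⟩ := h.dynamics
  refine ⟨C, hC, fun t ht htC => ⟨(h' t ⟨ht, htC⟩).1, fun i j => ?_, (h' t ⟨ht, htC⟩).2.2⟩⟩
  have htI := Ioo_subset_Icc_self ht
  rw [← hS.Zdot_eq hΘ htI (ha i t htI) (h.z_nonneg i j t htI)]
  exact (h' t ⟨ht, htC⟩).2.1 i j

/-- The parameter-time pairs close to `(Θ₀, τ)`. -/
def nearby (T : ℝ) (Θ₀ : Params d) (τ : ℝ) : Filter (Params d × ℝ) := 𝓝 Θ₀ ×ˢ 𝓝[Icc 0 T] τ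

/-- One time window serves all nearby parameters, so that `R` can be used along a whole time
interval with the parameter fixed. -/
theorem eventually_nearby_box {R : Params d → ℝ → Prop} {τ : ℝ}
    (h : ∀ᶠ q in nearby T Θ₀ τ, R q.1 q.2) :
    ∃ η > 0, ∀ᶠ Θ in 𝓝 Θ₀, ∀ s ∈ Icc 0 T, |s - τ| < η → R Θ s := by
  obtain ⟨pa, hpa, pb, hpb, hR⟩ := eventually_prod_iff.1 h
  obtain ⟨η, hη, hpb⟩ := Metric.eventually_nhds_iff.1 (eventually_nhdsWithin_iff.1 hpb)
  refine ⟨η, hη, hpa.mono fun Θ hΘ s hs hsτ => hR hΘ (hpb ?_ hs)⟩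
  rwa [Real.dist_eq]

namespace Admissible

variable (hS : S.Admissible T F Θ₀) (hF : F ∈ 𝓝 Θ₀)
include hS

include hF

/-- Joint continuity comes from continuity in time at `Θ₀` and the Lipschitz bound in the parameter
that is uniform in time. -/
theorem tendsto_s (j : Fin N) {τ : ℝ} (hτ : τ ∈ Icc 0 T) :
    Tendsto (fun q : Params d × ℝ => S.s j q.1 q.2) (nearby T Θ₀ τ) (𝓝 (S.s j Θ₀ τ)) := by
  obtain ⟨K, V, hV, hK⟩ := hS.s_lip j
  have h1 : Tendsto (fun q : Params d × ℝ => S.s j Θ₀ q.2) (nearby T Θ₀ τ) (𝓝 (S.s j Θ₀ τ)) :=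
    (hS.s_cont j Θ₀ (mem_of_mem_nhds hF) τ hτ).tendsto.comp tendsto_snd
  refine h1.congr_dist ?_
  have h2 : Tendsto (fun q : Params d × ℝ => (K : ℝ) * dist Θ₀ q.1) (nearby T Θ₀ τ) (𝓝 0) := by
    have : Tendsto (fun Θ : Params d => (K : ℝ) * dist Θ₀ Θ) (𝓝 Θ₀) (𝓝 0) := by
      have : Continuous fun Θ : Params d => (K : ℝ) * dist Θ₀ Θ := by fun_prop
      simpa using this.tendsto Θ₀
    exact this.comp tendsto_fst
  refine squeeze_zero' (Eventually.of_forall fun _ => dist_nonneg) ?_ h2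
  filter_upwards [(show ∀ᶠ Θ in 𝓝 Θ₀, Θ ∈ V from hV).prod_mk
    (self_mem_nhdsWithin : Icc 0 T ∈ 𝓝[Icc 0 T] τ)] with q hq
  exact (hK q.2 hq.2).dist_le_mul Θ₀ (mem_of_mem_nhds hV) q.1 hq.1

theorem tendsto_D (i : Fin M) (j : Fin N) {τ : ℝ} (hτ : τ ∈ Icc 0 T) :
    Tendsto (fun q : Params d × ℝ => S.D i j q.1 q.2) (nearby T Θ₀ τ) (𝓝 (S.D i j Θ₀ τ)) :=
  tendsto_const_nhds.dist (hS.tendsto_s hF j hτ)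

theorem tendsto_DB (j : Fin N) {τ : ℝ} (hτ : τ ∈ Icc 0 T) :
    Tendsto (fun q : Params d × ℝ => S.DB j q.1 q.2) (nearby T Θ₀ τ) (𝓝 (S.DB j Θ₀ τ)) :=
  tendsto_const_nhds.dist (hS.tendsto_s hF j hτ)

theorem eventually_out_of_range {i : Fin M} {j : Fin N} {τ : ℝ} (hτ : τ ∈ Icc 0 T)
    (h : S.r i j < S.D i j Θ₀ τ) :
    ∀ᶠ q in nearby T Θ₀ τ, S.r i j < S.D i j q.1 q.2 :=
  (hS.tendsto_D hF i j hτ).eventually_const_lt h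

/-- An agent within range of a target delivers nothing. -/
theorem eventually_PB_eq_zero {i : Fin M} {j : Fin N} {τ : ℝ} (hτ : τ ∈ Icc 0 T)
    (h : S.D i j Θ₀ τ ≤ S.r i j) : ∀ᶠ q in nearby T Θ₀ τ, S.PB j q.1 q.2 = 0 :=
  ((hS.tendsto_DB hF j hτ).eventually_const_lt (hS.rB_lt_DB h)).mono fun _ h => hS.PB_eq_zero h

omit hF in
theorem eventually_conn_eq {i : Fin M} {τ : ℝ} (hτ : τ ∈ Icc 0 T)
    (h : ∀ j, ¬ HitsZero T (S.Dplus i j Θ₀) τ ∧ ¬ LeavesZero T (S.Dplus i j Θ₀) τ) :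
    ∀ᶠ q in nearby T Θ₀ τ, S.conn q.1 q.2 i = S.conn Θ₀ τ i := by
  have := hS.conn_locConst i τ hτ h
  rwa [nhdsWithin_prod_eq, nhdsWithin_univ] at this

theorem continuousOn_D (i : Fin M) (j : Fin N) : ContinuousOn (S.D i j Θ₀) (Icc 0 T) :=
  fun t ht => tendsto_const_nhds.dist (hS.s_cont j Θ₀ (mem_of_mem_nhds hF) t ht)

theorem continuousOn_Dplus (i : Fin M) (j : Fin N) : ContinuousOn (S.Dplus i j Θ₀) (Icc 0 T) :=
  continuousOn_const.sup ((hS.continuousOn_D hF i j).sub continuousOn_const)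

omit hF in
theorem exists_P_lipschitz (i : Fin M) (j : Fin N) :
    ∃ K : ℝ, 0 ≤ K ∧ ∀ᶠ Θ in 𝓝 Θ₀, ∀ t ∈ Icc 0 T,
      |S.P i j Θ t - S.P i j Θ₀ t| ≤ K * ‖Θ - Θ₀‖ := by
  obtain ⟨K₁, hK₁⟩ := hS.p_lip i j
  obtain ⟨K₂, V, hV, hK₂⟩ := hS.s_lip j
  refine ⟨K₁ * K₂, by positivity, ?_⟩
  filter_upwards [hV] with Θ hΘ t ht
  have h1 := hK₁.dist_le_mul _ (mem_Ici.2 (dist_nonneg : 0 ≤ S.D i j Θ t)) _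
    (mem_Ici.2 (dist_nonneg : 0 ≤ S.D i j Θ₀ t))
  have h2 := (hK₂ t ht).dist_le_mul Θ hΘ Θ₀ (mem_of_mem_nhds hV)
  have h3 : dist (S.D i j Θ t) (S.D i j Θ₀ t) ≤ dist (S.s j Θ t) (S.s j Θ₀ t) := by
    have := dist_dist_dist_le (S.w i) (S.s j Θ t) (S.w i) (S.s j Θ₀ t)
    rwa [dist_self, zero_add] at this
  rw [← Real.dist_eq, ← dist_eq_norm, mul_assoc]
  exact h1.trans (mul_le_mul_of_nonneg_left (h3.trans h2) K₁.2)

end Admissible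

end Setting

end DataHarvesting

/-! ### Propagation criteria and joint continuity in parameter and time. -/

namespace DataHarvesting

theorem abs_sub_le_of_abs_deriv_le_off_finite {C : Set ℝ} (hC : C.Finite) {f : ℝ → ℝ} {c T : ℝ}
    (hf : ContinuousOn f (Icc 0 T))
    (h : ∀ s ∈ Ioo 0 T, s ∉ C → ∃ f', HasDerivAt f f' s ∧ |f'| ≤ c) :
    ∀ s ∈ Icc 0 T, ∀ t ∈ Icc 0 T, |f t - f s| ≤ c * |t - s| := by
  have key : ∀ s ∈ Icc 0 T, ∀ t ∈ Icc 0 T, s ≤ t → |f t - f s| ≤ c * |t - s| := by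
    intro s hs t ht hst
    have hc := hf.mono (Icc_subset_Icc hs.1 ht.2)
    have h1 := sub_le_mul_sub_of_deriv_le_off_finite (c := c) hC hst hc fun u hu huC => by
      obtain ⟨f', h1, h2⟩ := h u ⟨hs.1.trans_lt hu.1, hu.2.trans_le ht.2⟩ huC
      exact ⟨f', h1, (abs_le.1 h2).2⟩
    have h2 := sub_le_mul_sub_of_deriv_le_off_finite (c := c) hC hst hc.neg fun u hu huC => by
      obtain ⟨f', h1, h2⟩ := h u ⟨hs.1.trans_lt hu.1, hu.2.trans_le ht.2⟩ huC
      exact ⟨-f', h1.neg, by linarith [(abs_le.1 h2).1]⟩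
    simp only [Pi.neg_apply] at h2
    rw [abs_of_nonneg (sub_nonneg.2 hst), abs_le]
    constructor <;> linarith
  intro s hs t ht
  rcases le_total s t with h' | h'
  · exact key s hs t ht h'
  · rw [abs_sub_comm, abs_sub_comm t]
    exact key t ht s hs h'

/-- Provides the base point for increments across `τ`. Time 0 is allowed even if an event occurs
there, because the initial contents are differentiable by assumption. -/
theorem exists_notMem_near_le {T : ℝ} {B : Set ℝ} (hB : B.Finite) {p : ℝ → Prop} {τ : ℝ}
    (hτ : τ ∈ Icc 0 T) (h0 : τ = 0 → p 0) (hp : 0 < τ → ∀ᶠ u in 𝓝[<] τ, p u) :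
    ∀ η > 0, ∃ u ∈ Icc 0 T, (u = 0 ∨ u ∉ B) ∧ (u < τ ∧ u ∉ B ∨ u = 0 ∧ τ = 0) ∧ u ≤ τ ∧
      τ - η < u ∧ p u := by
  intro η hη
  rcases hτ.1.eq_or_lt with h | h
  · exact ⟨0, left_mem_Icc.2 (hτ.1.trans hτ.2), Or.inl rfl, Or.inr ⟨rfl, h.symm⟩, h.le,
      by linarith, h0 h.symm⟩
  · obtain ⟨u, ⟨h1, h2⟩, h3, h4, h5⟩ := ((hp h).and (Icc_mem_nhdsLT_of_lt h hτ.2)).and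
      ((eventually_notMem_nhdsLT hB τ).and
        (Ioo_mem_nhdsLT (show τ - η < τ by linarith))) |>.exists
    exact ⟨u, h2, Or.inr h3, Or.inl ⟨h5, h3⟩, h5.le, h4, h1⟩

/-- `Δ` is constant near `τ`, exceptional times apart. -/
def ConstNear {E : Type*} (T : ℝ) (B : Set ℝ) (Δ : ℝ → E) (τ : ℝ) : Prop :=
  ∃ W ∈ 𝓝[Icc 0 T] τ, ∀ u ∈ W, ∀ v ∈ W, u ∈ Icc 0 T → v ∈ Icc 0 T →
    (u = 0 ∨ u ∉ B) → (v = 0 ∨ v ∉ B) → Δ v = Δ u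

theorem exists_Icc_abs_lt_subset {T τ : ℝ} {W : Set ℝ} (h : W ∈ 𝓝[Icc 0 T] τ) :
    ∃ η > 0, ∀ s ∈ Icc 0 T, |s - τ| < η → s ∈ W := by
  obtain ⟨η, hη, hW⟩ := Metric.mem_nhdsWithin_iff.1 h
  exact ⟨η, hη, fun s hs hsη => hW ⟨by rwa [Metric.mem_ball, Real.dist_eq], hs⟩⟩

/-- The form in which propagation is applied: at each time either `Δ` does not change, or the time
is exceptional and smallness just after it follows from vanishing before it. -/
theorem eq_zero_of_constNear_or {E : Type*} [NormedAddCommGroup E] {T : ℝ} {B : Set ℝ}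
    (hB : B.Finite) {Δ : ℝ → E} (h0 : Δ 0 = 0)
    (h : ∀ τ ∈ Icc 0 T, ConstNear T B Δ τ ∨ (τ ∈ B ∧ (τ < T →
      (∀ u ∈ Ico 0 τ, u ∉ B → Δ u = 0) → ∀ ε > 0, ∀ᶠ v in 𝓝[>] τ, v ∉ B → ‖Δ v‖ ≤ ε))) :
    ∀ t ∈ Icc 0 T, t ∉ B → Δ t = 0 := by
  refine eq_zero_of_propagates hB h0 (fun τ hτ hτB => ?_) fun τ hτ hτB hbef ε hε => ?_
  · obtain ⟨W, hW, hc⟩ := (h τ hτ).resolve_right fun h' => hτB h'.1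
    have : ∀ᶠ v in 𝓝[Icc 0 T] τ, v ∉ B :=
      nhdsWithin_le_nhds (hB.isClosed.isOpen_compl.mem_nhds hτB)
    filter_upwards [hW, this, self_mem_nhdsWithin] with v hv hvB hvI
    exact hc τ (mem_of_mem_nhdsWithin hτ hW) v hv hτ hvI (Or.inr hτB) (Or.inr hvB)
  · rcases h τ ⟨hτ.1, hτ.2.le⟩ with ⟨W, hW, hc⟩ | h'
    · obtain ⟨η, hη, hηW⟩ := exists_Icc_abs_lt_subset hW
      obtain ⟨u, huI, hu, hu', huτ, hlt, -⟩ := exists_notMem_near_le hB ⟨hτ.1, hτ.2.le⟩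
        (p := fun _ => True) (fun _ => trivial) (fun _ => Eventually.of_forall fun _ => trivial)
        η hη
      have hu0 : Δ u = 0 := by
        rcases hu' with h' | h'
        · exact hbef u ⟨huI.1, h'.1⟩ h'.2
        · rw [h'.1, h0]
      filter_upwards [Icc_mem_nhdsGT_of_lt hτ.1 hτ.2,
        Ioo_mem_nhdsGT (show τ < τ + η by linarith)] with v hvI hvη hvB
      rw [hc u (hηW u huI (abs_lt.2 ⟨by linarith, by linarith⟩)) v
        (hηW v hvI (abs_lt.2 ⟨by linarith [hvη.1], by linarith [hvη.2]⟩)) huI hvI hu (Or.inr hvB),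
        hu0, norm_zero]
      exact hε.le
    · exact h'.2 hτ.2 hbef ε hε

namespace Setting

variable {M N : ℕ} {d : Fin N → ℕ} {S : Setting M N d} {T : ℝ} {F : Set (Params d)}
  {Θ₀ : Params d}

/-- Event times are included, although continuity in the parameter is known only off `B`: the
uniform Lipschitz bound in time permits comparison with a nearby time off `B`. -/
theorem tendsto_nearby {φ : Params d → ℝ → ℝ} {B : Set ℝ} (hF : F ∈ 𝓝 Θ₀) (hT : 0 < T)
    (hB : B.Finite) {L : ℝ}
    (hL : ∀ Θ ∈ F, ∀ s ∈ Icc 0 T, ∀ t ∈ Icc 0 T, |φ Θ t - φ Θ s| ≤ L * |t - s|)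
    (hc : ∀ t ∈ Icc 0 T, t ∉ B → ContinuousAt (fun Θ => φ Θ t) Θ₀) {τ : ℝ} (hτ : τ ∈ Icc 0 T) :
    Tendsto (fun q : Params d × ℝ => φ q.1 q.2) (nearby T Θ₀ τ) (𝓝 (φ Θ₀ τ)) := by
  have hΘ₀ := mem_of_mem_nhds hF
  have hL0 : 0 ≤ L := by
    have := (abs_nonneg _).trans (hL Θ₀ hΘ₀ 0 (left_mem_Icc.2 hT.le) T (right_mem_Icc.2 hT.le))
    rw [sub_zero, abs_of_pos hT] at this
    exact nonneg_of_mul_nonneg_left this hT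
  rw [Metric.tendsto_nhds]
  intro ε hε
  -- The time shifts add up to at most `3η` and cost at most `3ε/4`; the change of parameter at the
  -- auxiliary time `t` costs less than `ε/4`.
  set η := ε / (4 * (L + 1)) with hη
  have hη0 : 0 < η := by positivity
  have hLη : L * (2 * η) ≤ ε / 2 := by
    rw [hη]
    have : L * (2 * (ε / (4 * (L + 1)))) = ε / 2 * (L / (L + 1)) := by field_simp; ring
    rw [this]
    exact mul_le_of_le_one_right (by positivity) ((div_le_one (by positivity)).2 (by linarith))
  obtain ⟨t, htI, htB, htτ⟩ : ∃ t ∈ Icc 0 T, t ∉ B ∧ |t - τ| < η := by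
    rcases hτ.2.eq_or_lt with h | h
    · obtain ⟨t, ⟨h2, h3⟩, h1⟩ := (((eventually_notMem_nhdsLT hB τ).and
        (Ioo_mem_nhdsLT (show τ - η < τ by linarith))).and
          (Icc_mem_nhdsLT_of_lt (h ▸ hT) hτ.2)).exists
      exact ⟨t, h1, h2, abs_lt.2 ⟨by linarith [h3.1], by linarith [h3.2]⟩⟩
    · obtain ⟨t, ⟨h2, h3⟩, h1⟩ := (((eventually_notMem_nhdsGT hB τ).and
        (Ioo_mem_nhdsGT (show τ < τ + η by linarith))).and
          (Icc_mem_nhdsGT_of_lt hτ.1 h)).exists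
      exact ⟨t, h1, h2, abs_lt.2 ⟨by linarith [h3.1], by linarith [h3.2]⟩⟩
  have h1 : ∀ᶠ Θ in 𝓝 Θ₀, Θ ∈ F ∧ |φ Θ t - φ Θ₀ t| < ε / 4 :=
    (show ∀ᶠ Θ in 𝓝 Θ₀, Θ ∈ F from hF).and
      ((Metric.tendsto_nhds.1 (hc t htI htB) (ε / 4) (by positivity)).mono fun Θ h => by
        rwa [Real.dist_eq] at h)
  have h2 : ∀ᶠ s in 𝓝[Icc 0 T] τ, s ∈ Icc 0 T ∧ |s - τ| < η :=
    Filter.inter_mem self_mem_nhdsWithin (nhdsWithin_le_nhds (Metric.ball_mem_nhds τ hη0))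
  filter_upwards [h1.prod_mk h2] with q hq
  obtain ⟨⟨hqF, hq1⟩, hqI, hq2⟩ := hq
  have e1 := hL q.1 hqF t htI q.2 hqI
  have e2 := hL Θ₀ hΘ₀ τ hτ t htI
  have e3 : |q.2 - t| + |t - τ| ≤ 3 * η := by
    have := abs_sub_le q.2 τ t
    rw [abs_sub_comm τ t] at this
    linarith
  have e4 : L * |q.2 - t| + L * |t - τ| ≤ 3 / 2 * (L * (2 * η)) := by nlinarith
  rw [Real.dist_eq]
  have e5 : |φ q.1 q.2 - φ Θ₀ τ| ≤ |φ q.1 q.2 - φ q.1 t| + |φ q.1 t - φ Θ₀ t| +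
      |φ Θ₀ t - φ Θ₀ τ| := by
    have a1 := abs_sub_le (φ q.1 q.2) (φ q.1 t) (φ Θ₀ τ)
    have a2 := abs_sub_le (φ q.1 t) (φ Θ₀ t) (φ Θ₀ τ)
    linarith
  linarith

/-- If near `(Θ₀, τ)` the time derivative of `φ` does not depend on the parameter, then the
derivative of `φ` with respect to the parameter does not depend on time near `τ`. -/
theorem exists_nhds_fderiv_eq {φ : Params d → ℝ → ℝ} {ρ : ℝ → ℝ} {R : Params d → ℝ → Prop} {τ : ℝ}
    (hF : F ∈ 𝓝 Θ₀) (hφ : ∀ Θ ∈ F, ContinuousOn (φ Θ) (Icc 0 T))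
    (hd : ∀ Θ ∈ F, ∃ C : Set ℝ, C.Finite ∧ ∀ s ∈ Ioo 0 T, s ∉ C → R Θ s →
      HasDerivAt (φ Θ) (ρ s) s)
    (hR : ∀ᶠ q in nearby T Θ₀ τ, R q.1 q.2) :
    ∃ W ∈ 𝓝[Icc 0 T] τ, ∀ u ∈ W, ∀ v ∈ W, u ∈ Icc 0 T → v ∈ Icc 0 T →
      fderiv ℝ (fun Θ => φ Θ v) Θ₀ = fderiv ℝ (fun Θ => φ Θ u) Θ₀ := by
  obtain ⟨η, hη, hbox⟩ := eventually_nearby_box hR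
  have key : ∀ u ∈ Icc 0 T, ∀ v ∈ Icc 0 T, |u - τ| < η → |v - τ| < η → u ≤ v →
      fderiv ℝ (fun Θ => φ Θ v) Θ₀ = fderiv ℝ (fun Θ => φ Θ u) Θ₀ := by
    intro u hu v hv huη hvη huv
    have hΘ₀ := mem_of_mem_nhds hF
    -- The increment from `u` to `v` is the same for all nearby parameters, since its rate is `ρ`;
    -- so the two functions of `Θ` differ by a constant.
    refine fderiv_eq_of_sub_eq ?_
    filter_upwards [hF, hbox] with Θ hΘ hR
    obtain ⟨C₁, hC₁, hd₁⟩ := hd Θ hΘ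
    obtain ⟨C₂, hC₂, hd₂⟩ := hd Θ₀ hΘ₀
    have hsub : Icc u v ⊆ Icc 0 T := Icc_subset_Icc hu.1 hv.2
    have := sub_eq_sub_of_deriv_eq_off_finite (hC₁.union hC₂) huv ((hφ Θ hΘ).mono hsub)
      ((hφ Θ₀ hΘ₀).mono hsub) fun s hs hsC => by
        have hsI : s ∈ Ioo 0 T := ⟨hu.1.trans_lt hs.1, hs.2.trans_le hv.2⟩
        have hsη : |s - τ| < η := by
          rw [abs_lt] at *
          constructor <;> linarith [hs.1, hs.2]
        exact ⟨ρ s, hd₁ s hsI (fun h => hsC (Or.inl h)) (hR s (Ioo_subset_Icc_self hsI) hsη),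
          hd₂ s hsI (fun h => hsC (Or.inr h))
            (hbox.self_of_nhds s (Ioo_subset_Icc_self hsI) hsη)⟩
    linarith
  refine ⟨Metric.ball τ η, nhdsWithin_le_nhds (Metric.ball_mem_nhds τ hη), ?_⟩
  intro u hu v hv huI hvI
  rw [Metric.mem_ball, Real.dist_eq] at hu hv
  rcases le_total u v with h | h
  · exact key u huI v hvI hu hv h
  · exact (key v hvI u huI hv hu h).symm

end Setting

end DataHarvesting

/-! ### Derivatives of the target queues. -/

namespace DataHarvesting

namespace Setting

variable {M N : ℕ} {d : Fin N → ℕ} {S : Setting M N d} {T : ℝ} {F : Set (Params d)}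
  {Θ₀ : Params d}

/-- The times at which some event occurs on the observed sample path. -/
def allEventTimes (S : Setting M N d) (T : ℝ) (Θ₀ : Params d)
    (x : Fin M → Params d → ℝ → ℝ) (z : Fin M → Fin N → Params d → ℝ → ℝ) : Set ℝ :=
  ⋃ e, S.eventTimes T Θ₀ (fun i => x i Θ₀) (fun i j => z i j Θ₀) e

namespace IsSamplePath

section OnePath

variable {a : Fin M → ℝ → ℝ} {x : Fin M → Params d → ℝ → ℝ}
  {z : Fin M → Fin N → Params d → ℝ → ℝ} {y : Fin M → Params d → ℝ → ℝ}
  (h : S.IsSamplePath T F Θ₀ a x z y)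
include h

theorem finite_allEventTimes : (S.allEventTimes T Θ₀ x z).Finite :=
  finite_iUnion h.finite

variable (hS : S.Admissible T F Θ₀) (hF : F ∈ 𝓝 Θ₀)

omit h in
theorem mem_allEventTimes {t : ℝ} {e : Event M N}
    (he : t ∈ S.eventTimes T Θ₀ (fun i => x i Θ₀) (fun i j => z i j Θ₀) e) :
    t ∈ S.allEventTimes T Θ₀ x z := mem_iUnion.2 ⟨e, he⟩

include hF in
theorem fderiv_x_zero (i : Fin M) :
    fderiv ℝ (fun Θ => x i Θ 0) Θ₀ = fderiv ℝ (S.x₀ i) Θ₀ :=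
  Filter.EventuallyEq.fderiv_eq (by filter_upwards [hF] with Θ hΘ using (h.state Θ hΘ).x_init i)

include hF in
theorem fderiv_z_zero (i : Fin M) (j : Fin N) :
    fderiv ℝ (fun Θ => z i j Θ 0) Θ₀ = fderiv ℝ (S.z₀ i j) Θ₀ :=
  Filter.EventuallyEq.fderiv_eq (by filter_upwards [hF] with Θ hΘ using (h.state Θ hΘ).z_init i j)

include hF hS in
theorem differentiableAt_x (i : Fin M) {t : ℝ} (ht : t ∈ Icc 0 T)
    (hg : t = 0 ∨ t ∉ S.allEventTimes T Θ₀ x z) :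
    DifferentiableAt ℝ (fun Θ => x i Θ t) Θ₀ := by
  rcases hg with rfl | hg
  · exact (hS.x₀_diff i).congr_of_eventuallyEq
      (by filter_upwards [hF] with Θ hΘ using (h.state Θ hΘ).x_init i)
  · exact (h.diff t ht fun e he => hg (mem_allEventTimes he)).1 i

include hF hS in
theorem differentiableAt_z (i : Fin M) (j : Fin N) {t : ℝ} (ht : t ∈ Icc 0 T)
    (hg : t = 0 ∨ t ∉ S.allEventTimes T Θ₀ x z) :
    DifferentiableAt ℝ (fun Θ => z i j Θ t) Θ₀ := by
  rcases hg with rfl | hg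
  · exact (hS.z₀_diff i j).congr_of_eventuallyEq
      (by filter_upwards [hF] with Θ hΘ using (h.state Θ hΘ).z_init i j)
  · exact (h.diff t ht fun e he => hg (mem_allEventTimes he)).2 i j

include hF in
-- Contents are non-negative for all nearby parameters, so an empty queue is at a local minimum.
theorem fderiv_x_eq_zero (i : Fin M) {t : ℝ} (ht : t ∈ Icc 0 T) (h0 : x i Θ₀ t = 0) :
    fderiv ℝ (fun Θ => x i Θ t) Θ₀ = 0 :=
  IsLocalMin.fderiv_eq_zero (by
    filter_upwards [hF] with Θ hΘ
    rw [h0]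
    exact (h.state Θ hΘ).x_nonneg i t ht)

include hF in
theorem fderiv_z_eq_zero (i : Fin M) (j : Fin N) {t : ℝ} (ht : t ∈ Icc 0 T)
    (h0 : z i j Θ₀ t = 0) : fderiv ℝ (fun Θ => z i j Θ t) Θ₀ = 0 :=
  IsLocalMin.fderiv_eq_zero (by
    filter_upwards [hF] with Θ hΘ
    rw [h0]
    exact (h.state Θ hΘ).z_nonneg i j t ht)

include hF hS in
theorem tendsto_x (hT : 0 < T) (i : Fin M) {τ : ℝ} (hτ : τ ∈ Icc 0 T) :
    Tendsto (fun q : Params d × ℝ => x i q.1 q.2) (nearby T Θ₀ τ) (𝓝 (x i Θ₀ τ)) := by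
  obtain ⟨A, hA⟩ := (h.arrival_piecewise i).exists_bound
  refine tendsto_nearby hF hT h.finite_allEventTimes
    (L := A + ∑ j, S.μ i j * S.p i j 0) (fun Θ hΘ => ?_)
    (fun t ht htB => (h.differentiableAt_x hS hF i ht (Or.inr htB)).continuousAt) hτ
  obtain ⟨C, hC, hd⟩ := (h.state Θ hΘ).exists_finite_hasDerivAt hS hΘ h.arrival_nonneg
  refine abs_sub_le_of_abs_deriv_le_off_finite hC ((h.state Θ hΘ).x_cont i) fun s hs hsC =>
    ⟨_, (hd s hs hsC).1 i, ?_⟩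
  have hsI := Ioo_subset_Icc_self hs
  have hnn : ∀ j, 0 ≤ S.μ i j * S.p i j 0 := fun j =>
    mul_nonneg (hS.μ_nonneg i j) (hS.p_nonneg i j le_rfl)
  have h1 : S.drain i Θ s ≤ ∑ j, S.μ i j * S.p i j 0 := by
    rcases hc : S.conn Θ s i with _ | j
    · rw [drain_of_conn_none hc]
      exact Finset.sum_nonneg fun j _ => hnn j
    · rw [drain_of_conn_eq hc]
      exact (mul_le_mul_of_nonneg_left (hS.P_le i j Θ s) (hS.μ_nonneg i j)).trans
        (Finset.single_le_sum (fun j _ => hnn j) (Finset.mem_univ j))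
  have h2 := sub_drain_le_Xdot (S := S) i Θ s (a i s) (x i Θ s)
  have h3 := hS.Xdot_le (i := i) (Θ := Θ) (t := s) (x := x i Θ s) (h.arrival_nonneg i s hsI)
  have h4 := hA s hsI
  have h5 := h.arrival_nonneg i s hsI
  have h6 : 0 ≤ ∑ j, S.μ i j * S.p i j 0 := Finset.sum_nonneg fun j _ => hnn j
  rw [abs_le]
  constructor <;> linarith

include hF hS in
theorem tendsto_z (hT : 0 < T) (i : Fin M) (j : Fin N) {τ : ℝ} (hτ : τ ∈ Icc 0 T) :
    Tendsto (fun q : Params d × ℝ => z i j q.1 q.2) (nearby T Θ₀ τ) (𝓝 (z i j Θ₀ τ)) := by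
  refine tendsto_nearby hF hT h.finite_allEventTimes
    (L := S.μ i j * S.p i j 0 + S.β i j * S.pB j 0) (fun Θ hΘ => ?_)
    (fun t ht htB => (h.differentiableAt_z hS hF i j ht (Or.inr htB)).continuousAt) hτ
  obtain ⟨C, hC, hd⟩ := (h.state Θ hΘ).exists_finite_hasDerivAt hS hΘ h.arrival_nonneg
  refine abs_sub_le_of_abs_deriv_le_off_finite hC ((h.state Θ hΘ).z_cont i j) fun s hs hsC =>
    ⟨_, (hd s hs hsC).2.1 i j, ?_⟩
  have hsI := Ioo_subset_Icc_self hs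
  have h1 := hS.inflow_le (i := i) (j := j) (Θ := Θ) (t := s) (a := a i s) (x := x i Θ s)
  have h2 := hS.inflow_nonneg (i := i) (j := j) (Θ := Θ) (t := s) (x := x i Θ s)
    (h.arrival_nonneg i s hsI)
  have h3 := hS.outflow_le (i := i) (j := j) (Θ := Θ) (t := s) (z := z i j Θ s)
  have h4 := hS.outflow_nonneg (i := i) (j := j) (Θ := Θ) (t := s) (z := z i j Θ s)
  have h5 := mul_le_mul_of_nonneg_left (hS.P_le i j Θ s) (hS.μ_nonneg i j)
  rw [abs_le]
  constructor <;> linarith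

include hF in
theorem x_eventually_zero_or_leaves (i : Fin M) {τ : ℝ} (hτ : τ ∈ Ico 0 T) (h0 : x i Θ₀ τ = 0) :
    (∀ᶠ u in 𝓝[>] τ, x i Θ₀ u = 0) ∨ LeavesZero T (x i Θ₀) τ := by
  have hst := h.state Θ₀ (mem_of_mem_nhds hF)
  exact (eventually_zero_or_pos_nhdsGT (hst.x_cont i) (hst.x_nonneg i) (h.finite (.xiZero i))
    hτ).imp id fun h' => ⟨hτ.1, hτ.2, h0, h'⟩

include hF in
/-- Where the target queue is empty and neither fills nor becomes empty, it stays empty. -/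
theorem x_eventually_zero (i : Fin M) {τ : ℝ} (hτ : τ ∈ Icc 0 T) (h0 : x i Θ₀ τ = 0)
    (hh : ¬ HitsZero T (x i Θ₀) τ) (hl : ¬ LeavesZero T (x i Θ₀) τ) :
    ∀ᶠ u in 𝓝[Icc 0 T] τ, x i Θ₀ u = 0 := by
  have hst := h.state Θ₀ (mem_of_mem_nhds hF)
  exact eventually_zero_of_not_hits_of_not_leaves (hst.x_cont i) (hst.x_nonneg i)
    (h.finite (.xiZero i)) hτ h0 hh hl

include hF hS in
/-- The derivative of the contents of a target queue is continuous, with value zero, at a time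
when the queue ceases to be empty. -/
theorem norm_fderiv_x_le_of_leaves (i : Fin M) {τ : ℝ} (hl : LeavesZero T (x i Θ₀) τ) {ε : ℝ}
    (hε : 0 < ε) : ∀ᶠ v in 𝓝[>] τ, v ∉ S.allEventTimes T Θ₀ x z →
      ‖fderiv ℝ (fun Θ => x i Θ v) Θ₀‖ ≤ ε := by
  have hΘ₀ := mem_of_mem_nhds hF
  have hst := h.state Θ₀ hΘ₀
  have hτ : τ ∈ Icc 0 T := ⟨hl.1, hl.2.1.le⟩
  -- Since events do not coincide, the queue is also empty just before `τ`, and the connection does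
  -- not switch near `(Θ₀, τ)`.
  have hnh : ¬ HitsZero T (x i Θ₀) τ := fun hh =>
    absurd (h.simple (.xiZero i) (.xiPlus i) (by simp) (by simp) τ hh hl) (by simp)
  have hconn : ∀ᶠ q in nearby T Θ₀ τ, S.conn q.1 q.2 i = S.conn Θ₀ τ i :=
    hS.eventually_conn_eq hτ fun j =>
      ⟨fun hh => absurd (h.simple (.deltaZero i j) (.xiPlus i) (by simp) (by simp) τ hh hl)
        (by simp),
      fun hh => absurd (h.simple (.deltaPlus i j) (.xiPlus i) (by simp) (by simp) τ hh hl)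
        (by simp)⟩
  obtain ⟨η, hη, hbox⟩ := eventually_nearby_box
    (R := fun Θ s => S.conn Θ s i = S.conn Θ₀ τ i) hconn
  obtain ⟨K, hK, hdrain⟩ : ∃ K : ℝ, 0 ≤ K ∧ ∀ᶠ Θ in 𝓝 Θ₀, ∀ s ∈ Icc 0 T, |s - τ| < η →
      S.drain i Θ₀ s - S.drain i Θ s ≤ K * ‖Θ - Θ₀‖ := by
    rcases hc : S.conn Θ₀ τ i with _ | j
    · refine ⟨0, le_rfl, ?_⟩
      filter_upwards [hbox] with Θ hΘ s hs hsη
      rw [drain_of_conn_none ((hΘ s hs hsη).trans hc),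
        drain_of_conn_none ((hbox.self_of_nhds s hs hsη).trans hc)]
      simp
    · obtain ⟨K, hK, hP⟩ := hS.exists_P_lipschitz i j
      refine ⟨S.μ i j * K, mul_nonneg (hS.μ_nonneg i j) hK, ?_⟩
      filter_upwards [hbox, hP] with Θ hΘ hP s hs hsη
      rw [drain_of_conn_eq ((hΘ s hs hsη).trans hc),
        drain_of_conn_eq ((hbox.self_of_nhds s hs hsη).trans hc), ← mul_sub, mul_assoc]
      refine mul_le_mul_of_nonneg_left ?_ (hS.μ_nonneg i j)
      linarith [(abs_le.1 (hP s hs)).1]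
  have hpos : 0 < ε / (2 * (K + 1)) := by positivity
  -- Increments start from a time `u` at which the queue is empty: there its derivative is 0, so its
  -- content serves as the comparison function `g`.
  obtain ⟨u, huI, hu, -, huτ, hlt, hu0⟩ := exists_notMem_near_le h.finite_allEventTimes
    (p := fun u => x i Θ₀ u = 0) hτ (fun h' => h' ▸ hl.2.2.1) (fun hp =>
      (eventually_zero_or_pos_nhdsLT (hst.x_cont i) (hst.x_nonneg i) (h.finite (.xiZero i))
        ⟨hp, hτ.2⟩).resolve_right fun h' => hnh ⟨hp, hτ.2, hl.2.2.1, h'⟩)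
    (min η (ε / (2 * (K + 1)))) (lt_min hη hpos)
  filter_upwards [Icc_mem_nhdsGT_of_lt hl.1 hl.2.1, Ioo_mem_nhdsGT
    (show τ < τ + min η (ε / (2 * (K + 1))) by linarith [lt_min hη hpos])] with v hvI hv hvB
  have hm1 := min_le_left η (ε / (2 * (K + 1)))
  have hm2 := min_le_right η (ε / (2 * (K + 1)))
  have huv : u ≤ v := huτ.trans hv.1.le
  have hCε : K * (v - u) ≤ ε := by
    have h1 : v - u ≤ 2 * (ε / (2 * (K + 1))) := by linarith [hv.2]
    have h2 : K * (2 * (ε / (2 * (K + 1)))) = ε * (K / (K + 1)) := by field_simp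
    calc K * (v - u) ≤ K * (2 * (ε / (2 * (K + 1)))) := mul_le_mul_of_nonneg_left h1 hK
      _ = ε * (K / (K + 1)) := h2
      _ ≤ ε := mul_le_of_le_one_right hε.le ((div_le_one (by positivity)).2 (by linarith))
  refine (norm_fderiv_le_of_sub_le (mul_nonneg hK (sub_nonneg.2 huv))
    (h.differentiableAt_x hS hF i hvI (Or.inr hvB)).hasFDerivAt
    (g := fun Θ => x i Θ u) ?_ ?_).trans hCε
  · rw [← h.fderiv_x_eq_zero hF i huI hu0]
    exact (h.differentiableAt_x hS hF i huI hu).hasFDerivAt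
  · filter_upwards [hF, hdrain] with Θ hΘ hdr
    obtain ⟨C₁, hC₁, hd₁⟩ := (h.state Θ hΘ).exists_finite_hasDerivAt hS hΘ h.arrival_nonneg
    obtain ⟨C₂, hC₂, hd₂⟩ := hst.exists_finite_hasDerivAt hS hΘ₀ h.arrival_nonneg
    have hsub : Icc u v ⊆ Icc 0 T := Icc_subset_Icc huI.1 hvI.2
    -- Where `x i Θ` exceeds `x i Θ₀` it is positive and its rate is not truncated; the arrivals
    -- cancel and only the difference of the drains remains.
    have hkey := le_of_deriv_le_of_pos (f := fun s => x i Θ s - x i Θ₀ s) (hC₁.union hC₂)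
      (mul_nonneg hK (norm_nonneg (Θ - Θ₀))) huv
      ((((h.state Θ hΘ).x_cont i).mono hsub).sub ((hst.x_cont i).mono hsub))
      fun s hs hsC hspos => by
        have hsI : s ∈ Ioo 0 T := ⟨huI.1.trans_lt hs.1, hs.2.trans_le hvI.2⟩
        have hsI' := Ioo_subset_Icc_self hsI
        have hsη : |s - τ| < η := by
          rw [abs_lt]
          constructor <;> linarith [hs.1, hs.2, hv.2]
        refine ⟨_, ((hd₁ s hsI fun h => hsC (Or.inl h)).1 i).sub
          ((hd₂ s hsI fun h => hsC (Or.inr h)).1 i), ?_⟩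
        have hx : 0 < x i Θ s := by linarith [hst.x_nonneg i s hsI']
        rw [Xdot_of_pos hx]
        have := sub_drain_le_Xdot (S := S) i Θ₀ s (a i s) (x i Θ₀ s)
        linarith [hdr s hsI' hsη]
    have hux : 0 ≤ x i Θ u := (h.state Θ hΘ).x_nonneg i u huI
    rw [max_eq_left (by simpa [hu0] using hux)] at hkey
    calc x i Θ v - x i Θ₀ v ≤ x i Θ u - x i Θ₀ u + K * ‖Θ - Θ₀‖ * (v - u) := hkey
      _ = _ := by ring

end OnePath

section TwoPaths

variable {a₁ a₂ : Fin M → ℝ → ℝ} {x₁ x₂ : Fin M → Params d → ℝ → ℝ}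
  {z₁ z₂ : Fin M → Fin N → Params d → ℝ → ℝ} {y₁ y₂ : Fin M → Params d → ℝ → ℝ}
  (h₁ : S.IsSamplePath T F Θ₀ a₁ x₁ z₁ y₁) (h₂ : S.IsSamplePath T F Θ₀ a₂ x₂ z₂ y₂)
  (hE : S.eventTimes T Θ₀ (fun i => x₁ i Θ₀) (fun i j => z₁ i j Θ₀) =
    S.eventTimes T Θ₀ (fun i => x₂ i Θ₀) (fun i j => z₂ i j Θ₀))
include h₁ h₂ hE

omit h₁ h₂ in
theorem allEventTimes_eq : S.allEventTimes T Θ₀ x₁ z₁ = S.allEventTimes T Θ₀ x₂ z₂ := by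
  unfold allEventTimes
  rw [hE]

theorem x_pos_of_pos (hF : F ∈ 𝓝 Θ₀) (i : Fin M) {t : ℝ} (ht : t ∈ Icc 0 T)
    (hpos : 0 < x₁ i Θ₀ t) : 0 < x₂ i Θ₀ t := by
  have hst₁ := h₁.state Θ₀ (mem_of_mem_nhds hF)
  have hst₂ := h₂.state Θ₀ (mem_of_mem_nhds hF)
  refine pos_of_pos_of_hits (hst₁.x_cont i) (hst₁.x_nonneg i) (hst₂.x_cont i) (hst₂.x_nonneg i)
    (fun h0 => ?_) (fun τ hτ => ?_) (fun τ hτ => ?_) ht hpos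
  · rw [hst₂.x_init i, ← hst₁.x_init i]
    exact h0
  · have : τ ∈ S.eventTimes T Θ₀ (fun i => x₂ i Θ₀) (fun i j => z₂ i j Θ₀) (.xiZero i) := hτ
    rwa [← hE] at this
  · have : τ ∈ S.eventTimes T Θ₀ (fun i => x₁ i Θ₀) (fun i j => z₁ i j Θ₀) (.xiPlus i) := hτ
    rw [hE] at this
    exact this.2.2.2

theorem x_eq_zero_of_eq_zero (hF : F ∈ 𝓝 Θ₀) (i : Fin M) {t : ℝ} (ht : t ∈ Icc 0 T)
    (h0 : x₁ i Θ₀ t = 0) : x₂ i Θ₀ t = 0 := by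
  by_contra hne
  exact (x_pos_of_pos h₂ h₁ hE.symm hF i ht
    (((h₂.state Θ₀ (mem_of_mem_nhds hF)).x_nonneg i t ht).lt_of_ne' hne)).ne' h0

/-- While the queue is empty both derivatives vanish, and just after it leaves 0 both are small.
Where it is positive, the drains cancel in `x₁ - x₂`, even if the connection switches. -/
theorem fderiv_x_eq (hT : 0 < T) (hF : F ∈ 𝓝 Θ₀) (hS : S.Admissible T F Θ₀) (i : Fin M) {t : ℝ}
    (ht : t ∈ Icc 0 T) (hg : t = 0 ∨ t ∉ S.allEventTimes T Θ₀ x₁ z₁) :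
    fderiv ℝ (fun Θ => x₁ i Θ t) Θ₀ = fderiv ℝ (fun Θ => x₂ i Θ t) Θ₀ := by
  set Δ : ℝ → (Params d →L[ℝ] ℝ) := fun t =>
    fderiv ℝ (fun Θ => x₁ i Θ t) Θ₀ - fderiv ℝ (fun Θ => x₂ i Θ t) Θ₀ with hΔ
  have hΔ0 : Δ 0 = 0 := by
    rw [hΔ]
    simp only
    rw [h₁.fderiv_x_zero hF, h₂.fderiv_x_zero hF, sub_self]
  have hBeq := allEventTimes_eq hE
  rcases hg with rfl | htB
  · exact sub_eq_zero.1 hΔ0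
  have hst₁ := h₁.state Θ₀ (mem_of_mem_nhds hF)
  have hzero : ∀ s ∈ Icc 0 T, x₁ i Θ₀ s = 0 → Δ s = 0 := fun s hs h0 => by
    simp only [hΔ]
    rw [h₁.fderiv_x_eq_zero hF i hs h0,
      h₂.fderiv_x_eq_zero hF i hs (x_eq_zero_of_eq_zero h₁ h₂ hE hF i hs h0), sub_zero]
  refine sub_eq_zero.1 (eq_zero_of_constNear_or h₁.finite_allEventTimes hΔ0 (fun τ hτ => ?_)
    t ht htB)
  rcases (hst₁.x_nonneg i τ hτ).eq_or_lt with h0 | hpos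
  · by_cases hτB : τ ∈ S.allEventTimes T Θ₀ x₁ z₁
    · refine Or.inr ⟨hτB, fun hτT _ ε hε => ?_⟩
      rcases h₁.x_eventually_zero_or_leaves hF i ⟨hτ.1, hτT⟩ h0.symm with hz | hl
      · filter_upwards [hz, Icc_mem_nhdsGT_of_lt hτ.1 hτT] with v hv hvI _
        rw [hzero v hvI hv, norm_zero]
        exact hε.le
      · have hl₂ : LeavesZero T (x₂ i Θ₀) τ := by
          have : τ ∈ S.eventTimes T Θ₀ (fun i => x₁ i Θ₀) (fun i j => z₁ i j Θ₀) (.xiPlus i) := hl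
          rwa [hE] at this
        filter_upwards [h₁.norm_fderiv_x_le_of_leaves hS hF i hl (half_pos hε),
          h₂.norm_fderiv_x_le_of_leaves hS hF i hl₂ (half_pos hε)] with v hv₁ hv₂ hvB
        refine (norm_sub_le _ _).trans ?_
        linarith [hv₁ hvB, hv₂ (hBeq ▸ hvB)]
    · refine Or.inl ⟨_, h₁.x_eventually_zero hF i hτ h0.symm
        (fun hh => hτB (mem_allEventTimes (e := .xiZero i) hh))
        (fun hh => hτB (mem_allEventTimes (e := .xiPlus i) hh)), fun u hu v hv huI hvI _ _ => ?_⟩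
      rw [hzero u huI hu, hzero v hvI hv]
  · left
    have hpos₂ := x_pos_of_pos h₁ h₂ hE hF i hτ hpos
    -- Connections depend only on `Θ` and `t`, so both paths have the same drain and the difference
    -- grows at rate `a₁ - a₂`.
    obtain ⟨W, hW, hWc⟩ := exists_nhds_fderiv_eq (T := T) (Θ₀ := Θ₀) (τ := τ) (F := F)
      (φ := fun Θ s => x₁ i Θ s - x₂ i Θ s) (ρ := fun s => a₁ i s - a₂ i s)
      (R := fun Θ s => 0 < x₁ i Θ s ∧ 0 < x₂ i Θ s) hF
      (fun Θ hΘ => ((h₁.state Θ hΘ).x_cont i).sub ((h₂.state Θ hΘ).x_cont i))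
      (fun Θ hΘ => by
        obtain ⟨C₁, hC₁, hd₁⟩ := (h₁.state Θ hΘ).exists_finite_hasDerivAt hS hΘ h₁.arrival_nonneg
        obtain ⟨C₂, hC₂, hd₂⟩ := (h₂.state Θ hΘ).exists_finite_hasDerivAt hS hΘ h₂.arrival_nonneg
        refine ⟨C₁ ∪ C₂, hC₁.union hC₂, fun s hs hsC hR => ?_⟩
        have := ((hd₁ s hs fun h => hsC (Or.inl h)).1 i).sub
          ((hd₂ s hs fun h => hsC (Or.inr h)).1 i)
        rwa [Xdot_of_pos hR.1, Xdot_of_pos hR.2, sub_sub_sub_cancel_right] at this)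
      (((h₁.tendsto_x hS hF hT i hτ).eventually_const_lt hpos).and
        ((h₂.tendsto_x hS hF hT i hτ).eventually_const_lt hpos₂))
    refine ⟨W, hW, fun u hu v hv huI hvI hug hvg => ?_⟩
    have := hWc u hu v hv huI hvI
    rwa [fderiv_fun_sub (h₁.differentiableAt_x hS hF i hvI hvg)
      (h₂.differentiableAt_x hS hF i hvI (hBeq ▸ hvg)),
      fderiv_fun_sub (h₁.differentiableAt_x hS hF i huI hug)
      (h₂.differentiableAt_x hS hF i huI (hBeq ▸ hug))] at this

end TwoPaths

end IsSamplePath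

end Setting

end DataHarvesting

/-! ### Small jumps. -/

namespace DataHarvesting

/-- `Δ` has at most a small jump at `τ`: its increments across `τ` are controlled by the length
of the interval. -/
def SmallJump {E : Type*} [NormedAddCommGroup E] (T : ℝ) (B : Set ℝ) (Δ : ℝ → E) (τ : ℝ) : Prop :=
  ∃ K η, 0 ≤ K ∧ 0 < η ∧ ∀ u ∈ Icc 0 T, ∀ v ∈ Icc 0 T, τ - η < u → u ≤ τ →
    (u < τ ∧ u ∉ B ∨ u = 0 ∧ τ = 0) → τ < v → v < τ + η → v ∉ B → ‖Δ v - Δ u‖ ≤ K * (v - u)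

namespace SmallJump

variable {E : Type*} [NormedAddCommGroup E] {T : ℝ} {B : Set ℝ} {Δ Δ' : ℝ → E} {τ : ℝ}

theorem congr (h : SmallJump T B Δ τ)
    (heq : ∀ t ∈ Icc 0 T, (t = 0 ∨ t ∉ B) → Δ t = Δ' t) : SmallJump T B Δ' τ := by
  obtain ⟨K, η, hK, hη, h⟩ := h
  refine ⟨K, η, hK, hη, fun u hu v hv h1 h2 h3 h4 h5 h6 => ?_⟩
  rw [← heq u hu (h3.elim (fun h => Or.inr h.2) fun h => Or.inl h.1), ← heq v hv (Or.inr h6)]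
  exact h u hu v hv h1 h2 h3 h4 h5 h6

theorem sub (h : SmallJump T B Δ τ) (h' : SmallJump T B Δ' τ) :
    SmallJump T B (fun t => Δ t - Δ' t) τ := by
  obtain ⟨K, η, hK, hη, h⟩ := h
  obtain ⟨K', η', hK', hη', h'⟩ := h'
  refine ⟨K + K', min η η', add_nonneg hK hK', lt_min hη hη',
    fun u hu v hv h1 h2 h3 h4 h5 h6 => ?_⟩
  have m1 := min_le_left η η'
  have m2 := min_le_right η η'
  have e1 := h u hu v hv (by linarith) h2 h3 h4 (by linarith) h6
  have e2 := h' u hu v hv (by linarith) h2 h3 h4 (by linarith) h6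
  rw [sub_sub_sub_comm]
  refine (norm_sub_le _ _).trans ?_
  linarith

theorem of_eventually_eq (h : ∀ᶠ t in 𝓝[Icc 0 T] τ, Δ t = 0) : SmallJump T B Δ τ := by
  obtain ⟨η, hη, h⟩ := exists_Icc_abs_lt_subset h
  refine ⟨0, η, le_rfl, hη, fun u hu v hv h1 h2 _ h4 h5 _ => ?_⟩
  rw [show Δ u = 0 from h u hu (abs_lt.2 ⟨by linarith, by linarith⟩),
    show Δ v = 0 from h v hv (abs_lt.2 ⟨by linarith, by linarith⟩)]
  simp

theorem of_constNear (h : ConstNear T B Δ τ) : SmallJump T B Δ τ := by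
  obtain ⟨W, hW, h⟩ := h
  obtain ⟨η, hη, hηW⟩ := exists_Icc_abs_lt_subset hW
  refine ⟨0, η, le_rfl, hη, fun u hu v hv h1 h2 h3 h4 h5 h6 => ?_⟩
  rw [h u (hηW u hu (abs_lt.2 ⟨by linarith, by linarith⟩)) v
    (hηW v hv (abs_lt.2 ⟨by linarith, by linarith⟩)) hu hv
    (h3.elim (fun h => Or.inr h.2) fun h => Or.inl h.1) (Or.inr h6)]
  simp

theorem sum {ι : Type*} {Δ : ι → ℝ → E} (A : Finset ι) (h : ∀ l ∈ A, SmallJump T B (Δ l) τ) :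
    SmallJump T B (fun t => ∑ l ∈ A, Δ l t) τ := by
  classical
  induction A using Finset.induction_on with
  | empty => exact of_eventually_eq (by simp)
  | insert l A hl ih =>
    have h1 := (of_eventually_eq (B := B) (Δ := fun _ => (0 : E)) (T := T) (τ := τ) (by simp)).sub
      (ih fun l hl => h l (Finset.mem_insert_of_mem hl))
    refine ((h l (Finset.mem_insert_self l A)).sub h1).congr fun t _ _ => ?_
    rw [Finset.sum_insert hl, zero_sub, sub_neg_eq_add]

theorem eventually_norm_le (h : SmallJump T B Δ τ) (hB : B.Finite) (hτ : τ ∈ Ico 0 T)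
    (h0 : Δ 0 = 0) (hbef : ∀ u ∈ Ico 0 τ, u ∉ B → Δ u = 0) {ε : ℝ} (hε : 0 < ε) :
    ∀ᶠ v in 𝓝[>] τ, v ∉ B → ‖Δ v‖ ≤ ε := by
  obtain ⟨K, η, hK, hη, h⟩ := h
  -- With `u` and `v` this close to `τ`, `K * (v - u) ≤ ε`; the `+ 1` covers `K = 0`.
  have hpos : 0 < ε / (2 * (K + 1)) := by positivity
  have hm := lt_min hη hpos
  have hm1 := min_le_left η (ε / (2 * (K + 1)))
  have hm2 := min_le_right η (ε / (2 * (K + 1)))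
  obtain ⟨u, huI, -, hu', huτ, hlt, -⟩ := exists_notMem_near_le hB ⟨hτ.1, hτ.2.le⟩
    (p := fun _ => True) (fun _ => trivial) (fun _ => Eventually.of_forall fun _ => trivial)
    _ hm
  have hu0 : Δ u = 0 := by
    rcases hu' with h' | h'
    · exact hbef u ⟨huI.1, h'.1⟩ h'.2
    · rw [h'.1, h0]
  filter_upwards [Icc_mem_nhdsGT_of_lt hτ.1 hτ.2, Ioo_mem_nhdsGT
    (show τ < τ + min η (ε / (2 * (K + 1))) by linarith)] with v hvI hv hvB
  have h1 := h u huI v hvI (by linarith) huτ hu' hv.1 (by linarith [hv.2]) hvB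
  rw [hu0, sub_zero] at h1
  have h2 : v - u ≤ 2 * (ε / (2 * (K + 1))) := by linarith [hv.2]
  have h3 : K * (2 * (ε / (2 * (K + 1)))) = ε * (K / (K + 1)) := by field_simp
  calc ‖Δ v‖ ≤ K * (v - u) := h1
    _ ≤ K * (2 * (ε / (2 * (K + 1)))) := mul_le_mul_of_nonneg_left h2 hK
    _ = ε * (K / (K + 1)) := h3
    _ ≤ ε := mul_le_of_le_one_right hε.le ((div_le_one (by positivity)).2 (by linarith))

end SmallJump

/-! ### On-board contents when the connection to an empty target switches. -/

namespace Setting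

variable {M N : ℕ} {d : Fin N → ℕ} {S : Setting M N d} {T : ℝ} {F : Set (Params d)}
  {Θ₀ : Params d}

theorem outflow_of_PB_eq_zero {i : Fin M} {j : Fin N} {Θ : Params d} {t z : ℝ}
    (h : S.PB j Θ t = 0) : S.outflow i j Θ t z = 0 := by
  simp [outflow, h]

theorem outflow_of_pos {i : Fin M} {j : Fin N} {Θ : Params d} {t z : ℝ}
    (h : 0 < z) : S.outflow i j Θ t z = S.β i j * S.PB j Θ t := by
  simp [outflow, h]

theorem eventually_of_nearby {p : Params d × ℝ → Prop} {τ : ℝ} (h : ∀ᶠ q in nearby T Θ₀ τ, p q) :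
    ∀ᶠ s in 𝓝[Icc 0 T] τ, p (Θ₀, s) :=
  (Filter.Tendsto.prodMk (tendsto_const_pure.mono_right (pure_le_nhds Θ₀)) tendsto_id).eventually h

namespace IsSamplePath

section OnePath

variable {a : Fin M → ℝ → ℝ} {x : Fin M → Params d → ℝ → ℝ}
  {z : Fin M → Fin N → Params d → ℝ → ℝ} {y : Fin M → Params d → ℝ → ℝ}
  (h : S.IsSamplePath T F Θ₀ a x z y) (hS : S.Admissible T F Θ₀) (hF : F ∈ 𝓝 Θ₀)
include h hS

omit h in
theorem eventually_conn_eq_of_notMem {s : ℝ} (i : Fin M) (hs : s ∈ Ioo 0 T)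
    (hsB : s ∉ S.allEventTimes T Θ₀ x z) : ∀ᶠ u in 𝓝 s, S.conn Θ₀ u i = S.conn Θ₀ s i := by
  have h1 := eventually_of_nearby (hS.eventually_conn_eq (i := i) (Ioo_subset_Icc_self hs) fun j =>
    ⟨fun hh => hsB (mem_allEventTimes (e := .deltaZero i j) hh),
      fun hh => hsB (mem_allEventTimes (e := .deltaPlus i j) hh)⟩)
  rwa [nhdsWithin_eq_nhds.2 (Icc_mem_nhds hs.1 hs.2)] at h1

theorem exists_conn_eq_right (i : Fin M) {τ : ℝ} (hτ : τ ∈ Ico 0 T) :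
    ∃ c, ∃ b > τ, ∀ s ∈ Ioo τ b, S.conn Θ₀ s i = c := by
  obtain ⟨b, hb, hbB⟩ := (mem_nhdsGT_iff_exists_Ioo_subset' hτ.2).1
    ((eventually_notMem_nhdsGT h.finite_allEventTimes τ).and (Ioo_mem_nhdsGT hτ.2))
  obtain ⟨s₀, hs₀⟩ := exists_between (show τ < b from hb)
  exact ⟨S.conn Θ₀ s₀ i, b, hb, fun s hs => eq_of_locally_eq_on_Ioo (f := fun u => S.conn Θ₀ u i)
    (fun u hu => eventually_conn_eq_of_notMem hS i ⟨hτ.1.trans_lt hu.1, (hbB hu).2.2⟩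
      (hbB hu).1) hs hs₀⟩

theorem exists_conn_eq_left (i : Fin M) {τ : ℝ} (hτ : τ ∈ Icc 0 T) :
    ∃ c, ∃ b < τ, (τ = 0 → c = none) ∧ ∀ s ∈ Ioo b τ, 0 < s → S.conn Θ₀ s i = c := by
  rcases hτ.1.eq_or_lt with h0 | hpos
  · exact ⟨none, τ - 1, by linarith, fun _ => rfl, fun s hs hs0 => by linarith [hs.2]⟩
  obtain ⟨b, hb, hbB⟩ := (mem_nhdsLT_iff_exists_Ioo_subset' hpos).1
    ((eventually_notMem_nhdsLT h.finite_allEventTimes τ).and (Ioo_mem_nhdsLT hpos))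
  obtain ⟨s₀, hs₀⟩ := exists_between (show b < τ from hb)
  exact ⟨S.conn Θ₀ s₀ i, b, hb, fun h' => absurd h' hpos.ne', fun s hs _ =>
    eq_of_locally_eq_on_Ioo (f := fun u => S.conn Θ₀ u i)
    (fun u hu => eventually_conn_eq_of_notMem hS i ⟨(hbB hu).2.1, hu.2.trans_le hτ.2⟩
      (hbB hu).1) hs hs₀⟩

include hF

/-- Out of range nothing is collected, so the contents cannot grow. -/
theorem z_eventually_zero_of_out_of_range {i : Fin M} {j : Fin N} {τ : ℝ} (hτ : τ ∈ Ico 0 T)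
    (hD : S.r i j < S.D i j Θ₀ τ) (h0 : z i j Θ₀ τ = 0) : ∀ᶠ u in 𝓝[>] τ, z i j Θ₀ u = 0 := by
  have hΘ₀ := mem_of_mem_nhds hF
  have hst := h.state Θ₀ hΘ₀
  obtain ⟨C, hC, hd⟩ := hst.exists_finite_hasDerivAt hS hΘ₀ h.arrival_nonneg
  obtain ⟨η, hη, hW⟩ := exists_Icc_abs_lt_subset (eventually_of_nearby
    (hS.eventually_out_of_range hF ⟨hτ.1, hτ.2.le⟩ hD))
  filter_upwards [Icc_mem_nhdsGT_of_lt hτ.1 hτ.2,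
    Ioo_mem_nhdsGT (show τ < τ + η by linarith)] with v hvI hv
  have hsub : Icc τ v ⊆ Icc 0 T := Icc_subset_Icc hτ.1 hvI.2
  have := sub_le_mul_sub_of_deriv_le_off_finite (c := 0) hC hv.1.le ((hst.z_cont i j).mono hsub)
    fun s hs hsC => by
      have hsI : s ∈ Ioo 0 T := ⟨hτ.1.trans_lt hs.1, hs.2.trans_le hvI.2⟩
      refine ⟨_, (hd s hsI hsC).2.1 i j, ?_⟩
      rw [inflow_of_conn_ne (hS.conn_ne_of_lt hΘ₀ (Ioo_subset_Icc_self hsI)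
        (hW s (Ioo_subset_Icc_self hsI)
          (abs_lt.2 ⟨by linarith [hs.1], by linarith [hs.2, hv.2]⟩)))]
      linarith [hS.outflow_nonneg (i := i) (j := j) (Θ := Θ₀) (t := s) (z := z i j Θ₀ s)]
  rw [h0] at this
  linarith [hst.z_nonneg i j v hvI]

/-- An agent that is connected neither just before nor just after `τ`. -/
theorem smallJump_fderiv_z_of_conn_ne {i : Fin M} {l : Fin N} {τ : ℝ} (hτ : τ ∈ Icc 0 T)
    (hD : S.D i l Θ₀ τ ≤ S.r i l) {b b' : ℝ} (hb : b < τ) (hb' : τ < b')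
    (hl : ∀ s ∈ Ioo b τ, 0 < s → S.conn Θ₀ s i ≠ some l)
    (hr : ∀ s ∈ Ioo τ b', S.conn Θ₀ s i ≠ some l) :
    SmallJump T (S.allEventTimes T Θ₀ x z)
      (fun t => fderiv ℝ (fun Θ => z i l Θ t) Θ₀) τ := by
  have hΘ₀ := mem_of_mem_nhds hF
  have hst := h.state Θ₀ hΘ₀
  obtain ⟨η, hη, hbox⟩ := eventually_nearby_box (R := fun Θ s => S.PB l Θ s = 0)
    (hS.eventually_PB_eq_zero hF hτ hD)
  refine ⟨0, min η (min (τ - b) (b' - τ)), le_rfl,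
    lt_min hη (lt_min (by linarith) (by linarith)), fun u hu v hv h1 h2 h3 h4 h5 h6 => ?_⟩
  have m1 := min_le_left η (min (τ - b) (b' - τ))
  have m2 := (min_le_right η (min (τ - b) (b' - τ))).trans (min_le_left _ _)
  have m3 := (min_le_right η (min (τ - b) (b' - τ))).trans (min_le_right _ _)
  have huv : u ≤ v := h2.trans h4.le
  have hsub : Icc u v ⊆ Icc 0 T := Icc_subset_Icc hu.1 hv.2
  -- No nearby parameter gives any delivery, and `Θ₀` gives no collection either, so `Θ₀` minimizes
  -- the increment. The connection at `τ` itself is unknown, hence `τ` joins the exceptional set.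
  have hmin : ∀ᶠ Θ in 𝓝 Θ₀, z i l Θ₀ v - z i l Θ₀ u ≤ z i l Θ v - z i l Θ u := by
    filter_upwards [hF, hbox] with Θ hΘ hR
    obtain ⟨C₁, hC₁, hd₁⟩ := (h.state Θ hΘ).exists_finite_hasDerivAt hS hΘ h.arrival_nonneg
    obtain ⟨C₂, hC₂, hd₂⟩ := hst.exists_finite_hasDerivAt hS hΘ₀ h.arrival_nonneg
    have := sub_le_mul_sub_of_deriv_le_off_finite (c := 0)
      (f := fun s => z i l Θ₀ s - z i l Θ s) ((hC₁.union hC₂).union (finite_singleton τ)) huv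
      (((hst.z_cont i l).mono hsub).sub (((h.state Θ hΘ).z_cont i l).mono hsub))
      fun s hs hsC => by
        have hsI : s ∈ Ioo 0 T := ⟨hu.1.trans_lt hs.1, hs.2.trans_le hv.2⟩
        have hsI' := Ioo_subset_Icc_self hsI
        have hsη : |s - τ| < η := by
          rw [abs_lt]
          constructor <;> linarith [hs.1, hs.2]
        have hne : S.conn Θ₀ s i ≠ some l := by
          rcases lt_trichotomy s τ with hlt | heq | hgt
          · exact hl s ⟨by linarith [hs.1], hlt⟩ hsI.1
          · exact absurd (Or.inr heq) hsC
          · exact hr s ⟨hgt, by linarith [hs.2]⟩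
        refine ⟨_, ((hd₂ s hsI fun h => hsC (Or.inl (Or.inr h))).2.1 i l).sub
          ((hd₁ s hsI fun h => hsC (Or.inl (Or.inl h))).2.1 i l), ?_⟩
        rw [inflow_of_conn_ne hne, outflow_of_PB_eq_zero (hR s hsI' hsη),
          outflow_of_PB_eq_zero (hbox.self_of_nhds s hsI' hsη)]
        have := hS.inflow_nonneg (i := i) (j := l) (Θ := Θ) (t := s) (x := x i Θ s)
          (h.arrival_nonneg i s hsI')
        linarith
    linarith
  have hu' : u = 0 ∨ u ∉ S.allEventTimes T Θ₀ x z :=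
    h3.elim (fun h => Or.inr h.2) fun h => Or.inl h.1
  have := IsLocalMin.fderiv_eq_zero (f := fun Θ => z i l Θ v - z i l Θ u) hmin
  rw [fderiv_fun_sub (h.differentiableAt_z hS hF i l hv (Or.inr h6))
    (h.differentiableAt_z hS hF i l hu hu')] at this
  rw [this]
  simp

/-- An agent that loses the connection to an empty target at `τ`. -/
theorem smallJump_fderiv_z_of_conn_left {i : Fin M} {l : Fin N} {τ : ℝ} (hτ : τ ∈ Ico 0 T)
    (hτ0 : 0 < τ) (hx : ∀ᶠ u in 𝓝[Icc 0 T] τ, x i Θ₀ u = 0)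
    (hD : S.D i l Θ₀ τ ≤ S.r i l) {b b' : ℝ} (hb : b < τ) (hb' : τ < b')
    (hl : ∀ s ∈ Ioo b τ, 0 < s → S.conn Θ₀ s i = some l)
    (hr : ∀ s ∈ Ioo τ b', S.conn Θ₀ s i ≠ some l) :
    SmallJump T (S.allEventTimes T Θ₀ x z)
      (fun t => fderiv ℝ (fun Θ => z i l Θ t) Θ₀) τ := by
  have hΘ₀ := mem_of_mem_nhds hF
  have hst := h.state Θ₀ hΘ₀
  have hτI : τ ∈ Icc 0 T := ⟨hτ.1, hτ.2.le⟩
  -- An agent that stayed within range would have kept its connection by `conn_persist`.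
  have hout : ∀ᶠ s in 𝓝[>] τ, S.r i l < S.D i l Θ₀ s := by
    rcases eventually_zero_or_pos_nhdsGT (hS.continuousOn_Dplus hF i l)
      (fun _ _ => le_max_left _ _) (h.finite (.deltaZero i l)) hτ with hz | hp
    · exfalso
      obtain ⟨b'', hb'', hbz⟩ := (mem_nhdsGT_iff_exists_Ioo_subset' hτ.2).1
        (hz.and (Ioo_mem_nhdsGT hτ.2))
      obtain ⟨s₁, hs₁⟩ := exists_between (max_lt hb hτ0)
      obtain ⟨s₂, hs₂⟩ := exists_between (lt_min hb' (show τ < b'' from hb''))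
      have hs₁b : b < s₁ := (le_max_left _ _).trans_lt hs₁.1
      have hs₁0 : 0 < s₁ := (le_max_right _ _).trans_lt hs₁.1
      have hs₂b : s₂ < b' := hs₂.2.trans_le (min_le_left _ _)
      have hs₂b' : s₂ < b'' := hs₂.2.trans_le (min_le_right _ _)
      have hs₂T : s₂ < T := (hbz ⟨hs₂.1, hs₂b'⟩).2.2
      refine hr s₂ ⟨hs₂.1, hs₂b⟩ (hS.conn_persist Θ₀ hΘ₀ s₁ ⟨hs₁0.le, hs₁.2.le.trans hτI.2⟩ s₂
        ⟨(hs₁.2.trans hs₂.1).le, hs₂T.le⟩ i l (hl s₁ ⟨hs₁b, hs₁.2⟩ hs₁0) fun s hs => ?_)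
      rcases lt_trichotomy s τ with hlt | heq | hgt
      · have hs0 : 0 < s := hs₁0.trans_le hs.1
        exact hS.conn_range Θ₀ hΘ₀ s ⟨hs0.le, hlt.le.trans hτI.2⟩ i l
          (hl s ⟨hs₁b.trans_le hs.1, hlt⟩ hs0)
      · rwa [heq]
      · have h1 : max 0 (S.D i l Θ₀ s - S.r i l) = 0 := (hbz ⟨hgt, hs.2.trans_lt hs₂b'⟩).1
        have h2 := le_max_right 0 (S.D i l Θ₀ s - S.r i l)
        linarith
    · filter_upwards [hp] with s hs
      have h1 : 0 < max 0 (S.D i l Θ₀ s - S.r i l) := hs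
      rcases lt_max_iff.1 h1 with h2 | h2
      · exact absurd h2 (lt_irrefl _)
      · linarith
  obtain ⟨b'', hb'', hbout⟩ := (mem_nhdsGT_iff_exists_Ioo_subset' hτ.2).1 hout
  have hb'' : τ < b'' := hb''
  obtain ⟨η, hη, hbox⟩ := eventually_nearby_box (R := fun Θ s => S.PB l Θ s = 0)
    (hS.eventually_PB_eq_zero hF hτI hD)
  obtain ⟨η', hη', hx0⟩ := exists_Icc_abs_lt_subset hx
  obtain ⟨K, hK, hP⟩ := hS.exists_P_lipschitz i l
  have hμK : 0 ≤ S.μ i l * K := mul_nonneg (hS.μ_nonneg i l) hK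
  refine ⟨S.μ i l * K, min (min η η') (min (τ - b) (b'' - τ)), hμK,
    lt_min (lt_min hη hη') (lt_min (by linarith) (by linarith)),
    fun u hu v hv h1 h2 h3 h4 h5 h6 => ?_⟩
  have m1 := (min_le_left (min η η') (min (τ - b) (b'' - τ))).trans (min_le_left _ _)
  have m2 := (min_le_left (min η η') (min (τ - b) (b'' - τ))).trans (min_le_right _ _)
  have m3 := (min_le_right (min η η') (min (τ - b) (b'' - τ))).trans (min_le_left _ _)
  have m4 := (min_le_right (min η η') (min (τ - b) (b'' - τ))).trans (min_le_right _ _)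
  have hu' : u = 0 ∨ u ∉ S.allEventTimes T Θ₀ x z :=
    h3.elim (fun h => Or.inr h.2) fun h => Or.inl h.1
  have hxu : x i Θ₀ u = 0 := hx0 u hu (abs_lt.2 ⟨by linarith, by linarith⟩)
  have hxτ : x i Θ₀ τ = 0 := hx0 τ hτI (by simpa using hη')
  have hsub₁ : Icc u τ ⊆ Icc 0 T := Icc_subset_Icc hu.1 hτI.2
  have hsub₂ : Icc τ v ⊆ Icc 0 T := Icc_subset_Icc hτ.1 hv.2
  -- For another parameter the agent may also collect what was in the target queue at time `u`. This
  -- extra term has zero derivative, since the queue is empty at `u` for `Θ₀`.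
  refine (norm_fderiv_le_of_sub_le (C := S.μ i l * K * (v - τ))
    (mul_nonneg hμK (by linarith))
    ((h.differentiableAt_z hS hF i l hv (Or.inr h6)).hasFDerivAt.sub
      (h.differentiableAt_z hS hF i l hu hu').hasFDerivAt) (g := fun Θ => x i Θ u) ?_ ?_).trans
    (mul_le_mul_of_nonneg_left (by linarith) hμK)
  · rw [← h.fderiv_x_eq_zero hF i hu hxu]
    exact (h.differentiableAt_x hS hF i hu hu').hasFDerivAt
  filter_upwards [hF, hbox, hP] with Θ hΘ hR hPΘ
  have hstΘ := h.state Θ hΘ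
  obtain ⟨C₁, hC₁, hd₁⟩ := hstΘ.exists_finite_hasDerivAt hS hΘ h.arrival_nonneg
  obtain ⟨C₂, hC₂, hd₂⟩ := hst.exists_finite_hasDerivAt hS hΘ₀ h.arrival_nonneg
  -- before `τ`, the agent collects at most what arrives; for `Θ₀` it collects all of it
  have e1 := sub_le_mul_sub_of_deriv_le_off_finite (c := 0)
    (f := fun s => (z i l Θ s + x i Θ s) - (z i l Θ₀ s + x i Θ₀ s)) (hC₁.union hC₂) h2
    ((((hstΘ.z_cont i l).add (hstΘ.x_cont i)).sub ((hst.z_cont i l).add (hst.x_cont i))).mono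
      hsub₁) fun s hs hsC => by
      have hsI : s ∈ Ioo 0 T := ⟨hu.1.trans_lt hs.1, hs.2.trans_le hτI.2⟩
      have hsI' := Ioo_subset_Icc_self hsI
      have hsη : |s - τ| < η := abs_lt.2 ⟨by linarith [hs.1], by linarith [hs.2]⟩
      have ha := h.arrival_nonneg i s hsI'
      have d₁ := hd₁ s hsI fun h => hsC (Or.inl h)
      have d₂ := hd₂ s hsI fun h => hsC (Or.inr h)
      refine ⟨_, ((d₁.2.1 i l).add (d₁.1 i)).sub ((d₂.2.1 i l).add (d₂.1 i)), ?_⟩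
      rw [outflow_of_PB_eq_zero (hR s hsI' hsη),
        outflow_of_PB_eq_zero (hbox.self_of_nhds s hsI' hsη),
        hS.inflow_of_conn_eq (hl s ⟨by linarith [hs.1], hs.2⟩ hsI.1) ha]
      have := hS.inflow_le_sub_Xdot (i := i) (j := l) (Θ := Θ) (t := s) (x := x i Θ s) ha
      linarith
  -- after `τ`, the agent is out of range for `Θ₀`
  have e2 := sub_le_mul_sub_of_deriv_le_off_finite (c := S.μ i l * (K * ‖Θ - Θ₀‖))
    (f := fun s => z i l Θ s - z i l Θ₀ s) (hC₁.union hC₂) h4.le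
    (((hstΘ.z_cont i l).sub (hst.z_cont i l)).mono hsub₂) fun s hs hsC => by
      have hsI : s ∈ Ioo 0 T := ⟨hτ.1.trans_lt hs.1, hs.2.trans_le hv.2⟩
      have hsI' := Ioo_subset_Icc_self hsI
      have hsη : |s - τ| < η := abs_lt.2 ⟨by linarith [hs.1], by linarith [hs.2]⟩
      have ha := h.arrival_nonneg i s hsI'
      have d₁ := hd₁ s hsI fun h => hsC (Or.inl h)
      have d₂ := hd₂ s hsI fun h => hsC (Or.inr h)
      refine ⟨_, (d₁.2.1 i l).sub (d₂.2.1 i l), ?_⟩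
      rw [outflow_of_PB_eq_zero (hR s hsI' hsη),
        outflow_of_PB_eq_zero (hbox.self_of_nhds s hsI' hsη)]
      have i1 := hS.inflow_le (i := i) (j := l) (Θ := Θ) (t := s) (a := a i s) (x := x i Θ s)
      have i2 := hS.inflow_nonneg (i := i) (j := l) (Θ := Θ₀) (t := s) (x := x i Θ₀ s) ha
      have i3 := hPΘ s hsI'
      rw [hS.P_eq_zero (hbout ⟨hs.1, by linarith [hs.2]⟩), sub_zero] at i3
      have i4 := mul_le_mul_of_nonneg_left ((le_abs_self _).trans i3) (hS.μ_nonneg i l)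
      linarith
  have e3 : 0 ≤ x i Θ τ := hstΘ.x_nonneg i τ hτI
  simp only [Pi.sub_apply]
  have e4 : S.μ i l * (K * ‖Θ - Θ₀‖) * (v - τ) = S.μ i l * K * (v - τ) * ‖Θ - Θ₀‖ := by ring
  simp only [hxu, hxτ] at e1 ⊢
  linarith

/-- At a switch of the connection to a target that stays empty, the derivatives of the on-board
contents of the agents within range are continuous. -/
theorem smallJump_fderiv_z {i : Fin M} {j : Fin N} {τ : ℝ} (hτ : τ ∈ Ico 0 T)
    (hx : ∀ᶠ u in 𝓝[Icc 0 T] τ, x i Θ₀ u = 0) (hD : S.D i j Θ₀ τ ≤ S.r i j) :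
    SmallJump T (S.allEventTimes T Θ₀ x z)
      (fun t => fderiv ℝ (fun Θ => z i j Θ t) Θ₀) τ := by
  classical
  have hΘ₀ := mem_of_mem_nhds hF
  have hτI : τ ∈ Icc 0 T := ⟨hτ.1, hτ.2.le⟩
  -- `c` and `c'` are the connections just before and just after `τ`. For `τ = 0` the default `c =
  -- none` ensures that no agent counts as losing a connection.
  obtain ⟨c, b, hb, hc0, hl⟩ := h.exists_conn_eq_left hS i hτI
  obtain ⟨c', b', hb', hr⟩ := h.exists_conn_eq_right hS i hτ
  have hother : ∀ l, S.D i l Θ₀ τ ≤ S.r i l → c' ≠ some l →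
      SmallJump T (S.allEventTimes T Θ₀ x z)
        (fun t => fderiv ℝ (fun Θ => z i l Θ t) Θ₀) τ := by
    intro l hDl hne
    have hr' : ∀ s ∈ Ioo τ b', S.conn Θ₀ s i ≠ some l := fun s hs => by rwa [hr s hs]
    by_cases hcl : c = some l
    · have hτ0 : 0 < τ := hτ.1.lt_of_ne' fun h' => by simp [hc0 h'] at hcl
      exact h.smallJump_fderiv_z_of_conn_left hS hF hτ hτ0 hx hDl hb hb'
        (fun s hs hs0 => (hl s hs hs0).trans hcl) hr'
    · exact h.smallJump_fderiv_z_of_conn_ne hS hF hτI hDl hb hb'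
        (fun s hs hs0 => by rwa [hl s hs hs0]) hr'
  by_cases hj : c' = some j
  swap
  · exact hother j hD hj
  -- Near `(Θ₀, τ)` only agents in `A` can collect, and none of them delivers; so their contents
  -- plus the target queue grow at the arrival rate, whatever the parameter.
  set A : Finset (Fin N) := Finset.univ.filter fun l => S.D i l Θ₀ τ ≤ S.r i l with hA
  have hmemA : ∀ l, l ∈ A ↔ S.D i l Θ₀ τ ≤ S.r i l := fun l => by simp [hA]
  have htot : ConstNear T (S.allEventTimes T Θ₀ x z)
      (fun t => fderiv ℝ (fun Θ => ∑ l ∈ A, z i l Θ t + x i Θ t) Θ₀) τ := by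
    have hR : ∀ᶠ q in nearby T Θ₀ τ, (∀ l, l ∈ A → S.PB l q.1 q.2 = 0) ∧
        ∀ l, l ∉ A → S.r i l < S.D i l q.1 q.2 := by
      refine (eventually_all.2 fun l => ?_).and (eventually_all.2 fun l => ?_)
      · by_cases hlA : l ∈ A
        · filter_upwards [hS.eventually_PB_eq_zero hF hτI ((hmemA l).1 hlA)] with q hq _ using hq
        · exact Eventually.of_forall fun q hq => absurd hq hlA
      · by_cases hlA : l ∈ A
        · exact Eventually.of_forall fun q hq => absurd hlA hq
        · filter_upwards [hS.eventually_out_of_range hF hτI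
            (not_le.1 fun h' => hlA ((hmemA l).2 h'))] with q hq _ using hq
    obtain ⟨W, hW, hWc⟩ := exists_nhds_fderiv_eq (T := T) (Θ₀ := Θ₀) (τ := τ) (F := F)
      (φ := fun Θ s => ∑ l ∈ A, z i l Θ s + x i Θ s) (ρ := fun s => a i s)
      (R := fun Θ s => (∀ l, l ∈ A → S.PB l Θ s = 0) ∧ ∀ l, l ∉ A → S.r i l < S.D i l Θ s) hF
      (fun Θ hΘ => (continuousOn_finsetSum _ fun l _ => (h.state Θ hΘ).z_cont i l).add
        ((h.state Θ hΘ).x_cont i))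
      (fun Θ hΘ => by
        obtain ⟨C, hC, hd⟩ := (h.state Θ hΘ).exists_finite_hasDerivAt hS hΘ h.arrival_nonneg
        refine ⟨C, hC, fun s hs hsC hR => ?_⟩
        have hsI := Ioo_subset_Icc_self hs
        have hder := (HasDerivAt.fun_sum fun l (_ : l ∈ A) => (hd s hs hsC).2.1 i l).add
          ((hd s hs hsC).1 i)
        rw [Finset.sum_congr rfl fun l hl => by
            rw [outflow_of_PB_eq_zero (hR.1 l hl), sub_zero],
          hS.sum_inflow (h.arrival_nonneg i s hsI) fun l hl => by
            by_contra hlA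
            exact hS.conn_ne_of_lt hΘ hsI (hR.2 l hlA) hl, sub_add_cancel] at hder
        exact hder) hR
    exact ⟨W, hW, fun u hu v hv huI hvI _ _ => hWc u hu v hv huI hvI⟩
  have hxz : SmallJump T (S.allEventTimes T Θ₀ x z)
      (fun t => fderiv ℝ (fun Θ => x i Θ t) Θ₀) τ :=
    SmallJump.of_eventually_eq (by
      filter_upwards [hx, self_mem_nhdsWithin] with t ht htI using h.fderiv_x_eq_zero hF i htI ht)
  -- Agent `j` is connected afterwards, so no other agent is; subtracting their small jumps from the
  -- conserved total leaves that of `j`.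
  have hrest := SmallJump.sum (A.erase j) fun l hl => hother l
    ((hmemA l).1 (Finset.mem_of_mem_erase hl)) fun h' => (Finset.ne_of_mem_erase hl)
      (Option.some_injective _ (h'.symm.trans hj))
  refine (((SmallJump.of_constNear htot).sub hxz).sub hrest).congr fun t ht htg => ?_
  rw [fderiv_fun_add (DifferentiableAt.fun_sum fun l _ => h.differentiableAt_z hS hF i l ht htg)
      (h.differentiableAt_x hS hF i ht htg),
    fderiv_fun_sum fun l _ => h.differentiableAt_z hS hF i l ht htg, add_sub_cancel_right,
    ← Finset.add_sum_erase A _ ((hmemA j).2 hD), add_sub_cancel_right]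

end OnePath

end IsSamplePath

end Setting

end DataHarvesting

/-! ### Comparison of on-board contents along two sample paths. -/

namespace DataHarvesting

namespace Setting

variable {M N : ℕ} {d : Fin N → ℕ} {S : Setting M N d} {T : ℝ} {F : Set (Params d)}
  {Θ₀ : Params d}

namespace IsSamplePath

section TwoPaths

variable {a₁ a₂ : Fin M → ℝ → ℝ} {x₁ x₂ : Fin M → Params d → ℝ → ℝ}
  {z₁ z₂ : Fin M → Fin N → Params d → ℝ → ℝ} {y₁ y₂ : Fin M → Params d → ℝ → ℝ}
  (h₁ : S.IsSamplePath T F Θ₀ a₁ x₁ z₁ y₁) (h₂ : S.IsSamplePath T F Θ₀ a₂ x₂ z₂ y₂)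
  (hE : S.eventTimes T Θ₀ (fun i => x₁ i Θ₀) (fun i j => z₁ i j Θ₀) =
    S.eventTimes T Θ₀ (fun i => x₂ i Θ₀) (fun i j => z₂ i j Θ₀))
  (hT : 0 < T) (hF : F ∈ 𝓝 Θ₀) (hS : S.Admissible T F Θ₀)
include h₁ h₂ hS

/-- While agent `j` delivers nothing and target `i` is not empty, on-board contents grow at a rate
that does not depend on the arrivals. -/
theorem exists_finite_hasDerivAt_z_sub_of_x_pos (i : Fin M) (j : Fin N) {Θ : Params d}
    (hΘ : Θ ∈ F) : ∃ C : Set ℝ, C.Finite ∧ ∀ s ∈ Ioo 0 T, s ∉ C →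
      (S.PB j Θ s = 0 ∧ 0 < x₁ i Θ s ∧ 0 < x₂ i Θ s) →
      HasDerivAt (fun s => z₁ i j Θ s - z₂ i j Θ s) 0 s := by
  obtain ⟨C₁, hC₁, hd₁⟩ := (h₁.state Θ hΘ).exists_finite_hasDerivAt hS hΘ h₁.arrival_nonneg
  obtain ⟨C₂, hC₂, hd₂⟩ := (h₂.state Θ hΘ).exists_finite_hasDerivAt hS hΘ h₂.arrival_nonneg
  refine ⟨C₁ ∪ C₂, hC₁.union hC₂, fun s hs hsC hR => ?_⟩
  have := ((hd₁ s hs fun h => hsC (Or.inl h)).2.1 i j).sub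
    ((hd₂ s hs fun h => hsC (Or.inr h)).2.1 i j)
  rwa [outflow_of_PB_eq_zero hR.1, outflow_of_PB_eq_zero hR.1, sub_zero, sub_zero,
    inflow_eq_of_pos hR.2.1 hR.2.2, sub_self] at this

include hE hT hF

/-- The record omits departures from 0 while `X_i > 0`, so these are matched directly: they occur
within range, where `z₁ - z₂` stays constant to the right of `τ`, and `z₁ = 0 ≤ z₂` at `τ`. -/
theorem z_pos_of_pos (i : Fin M) (j : Fin N) {t : ℝ} (ht : t ∈ Icc 0 T)
    (hpos : 0 < z₁ i j Θ₀ t) : 0 < z₂ i j Θ₀ t := by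
  have hΘ₀ := mem_of_mem_nhds hF
  have hst₁ := h₁.state Θ₀ hΘ₀
  have hst₂ := h₂.state Θ₀ hΘ₀
  refine pos_of_pos_of_hits (hst₁.z_cont i j) (hst₁.z_nonneg i j) (hst₂.z_cont i j)
    (hst₂.z_nonneg i j) (fun h0 => ?_) (fun τ hτ => ?_) (fun τ hτ => ?_) ht hpos
  · rw [hst₂.z_init i j, ← hst₁.z_init i j]
    exact h0
  · have : τ ∈ S.eventTimes T Θ₀ (fun i => x₂ i Θ₀) (fun i j => z₂ i j Θ₀) (.zetaZero i j) := hτ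
    rwa [← hE] at this
  have hτI : τ ∈ Icc 0 T := ⟨hτ.1, hτ.2.1.le⟩
  rcases (hst₁.x_nonneg i τ hτI).eq_or_lt with h0 | hxpos
  · have : τ ∈ S.eventTimes T Θ₀ (fun i => x₁ i Θ₀) (fun i j => z₁ i j Θ₀) (.zetaPlus i j) :=
      ⟨hτ, h0.symm⟩
    rw [hE] at this
    exact this.1.2.2.2
  have hxpos₂ := x_pos_of_pos h₁ h₂ hE hF i hτI hxpos
  have hD : S.D i j Θ₀ τ ≤ S.r i j := by
    by_contra! hD
    obtain ⟨u, hu1, hu2⟩ := (hτ.2.2.2.and (h₁.z_eventually_zero_of_out_of_range hS hF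
      ⟨hτ.1, hτ.2.1⟩ hD hτ.2.2.1)).exists
    exact hu1.ne' hu2
  have hR : ∀ᶠ q in nearby T Θ₀ τ, S.PB j q.1 q.2 = 0 ∧ 0 < x₁ i q.1 q.2 ∧ 0 < x₂ i q.1 q.2 :=
    (hS.eventually_PB_eq_zero hF hτI hD).and
      (((h₁.tendsto_x hS hF hT i hτI).eventually_const_lt hxpos).and
        ((h₂.tendsto_x hS hF hT i hτI).eventually_const_lt hxpos₂))
  obtain ⟨η, hη, hW⟩ := exists_Icc_abs_lt_subset (eventually_of_nearby hR)
  obtain ⟨C, hC, hd⟩ := exists_finite_hasDerivAt_z_sub_of_x_pos h₁ h₂ hS i j hΘ₀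
  filter_upwards [hτ.2.2.2, Icc_mem_nhdsGT_of_lt hτ.1 hτ.2.1,
    Ioo_mem_nhdsGT (show τ < τ + η by linarith)] with v hv0 hvI hv
  have hsub : Icc τ v ⊆ Icc 0 T := Icc_subset_Icc hτ.1 hvI.2
  have := sub_eq_sub_of_deriv_eq_off_finite hC hv.1.le
    (((hst₁.z_cont i j).sub (hst₂.z_cont i j)).mono hsub)
    (g := fun _ => (0 : ℝ)) continuousOn_const fun s hs hsC => by
      have hsI : s ∈ Ioo 0 T := ⟨hτ.1.trans_lt hs.1, hs.2.trans_le hvI.2⟩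
      exact ⟨0, hd s hsI hsC (hW s (Ioo_subset_Icc_self hsI)
        (abs_lt.2 ⟨by linarith [hs.1], by linarith [hs.2, hv.2]⟩)), hasDerivAt_const _ _⟩
  have h3 := hst₂.z_nonneg i j τ hτI
  have h4 := hτ.2.2.1
  simp only [Pi.sub_apply] at this
  linarith

theorem z_eq_zero_of_eq_zero (i : Fin M) (j : Fin N) {t : ℝ} (ht : t ∈ Icc 0 T)
    (h0 : z₁ i j Θ₀ t = 0) : z₂ i j Θ₀ t = 0 := by
  by_contra hne
  exact (z_pos_of_pos h₂ h₁ hE.symm hT hF hS i j ht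
    (((h₂.state Θ₀ (mem_of_mem_nhds hF)).z_nonneg i j t ht).lt_of_ne' hne)).ne' h0

omit hT in
theorem constNear_fderiv_z_sub (i : Fin M) (j : Fin N) {τ : ℝ} {R : Params d → ℝ → Prop}
    (hd : ∀ Θ ∈ F, ∃ C : Set ℝ, C.Finite ∧ ∀ s ∈ Ioo 0 T, s ∉ C → R Θ s →
      HasDerivAt (fun s => z₁ i j Θ s - z₂ i j Θ s) 0 s)
    (hR : ∀ᶠ q in nearby T Θ₀ τ, R q.1 q.2) :
    ConstNear T (S.allEventTimes T Θ₀ x₁ z₁) (fun t =>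
      fderiv ℝ (fun Θ => z₁ i j Θ t) Θ₀ - fderiv ℝ (fun Θ => z₂ i j Θ t) Θ₀) τ := by
  have hBeq := allEventTimes_eq hE
  obtain ⟨W, hW, hWc⟩ := exists_nhds_fderiv_eq (T := T) (Θ₀ := Θ₀) (τ := τ) (F := F)
    (φ := fun Θ s => z₁ i j Θ s - z₂ i j Θ s) (ρ := fun _ => 0) hF
    (fun Θ hΘ => ((h₁.state Θ hΘ).z_cont i j).sub ((h₂.state Θ hΘ).z_cont i j)) hd hR
  refine ⟨W, hW, fun u hu v hv huI hvI hug hvg => ?_⟩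
  have := hWc u hu v hv huI hvI
  rwa [fderiv_fun_sub (h₁.differentiableAt_z hS hF i j hvI hvg)
    (h₂.differentiableAt_z hS hF i j hvI (hBeq ▸ hvg)),
    fderiv_fun_sub (h₁.differentiableAt_z hS hF i j huI hug)
    (h₂.differentiableAt_z hS hF i j huI (hBeq ▸ hug))] at this

omit h₂ hE hT in
/-- While agent `j` is connected to target `i`, the sum of both contents grows at the arrival
rate. -/
theorem constNear_fderiv_z_add_fderiv_x (i : Fin M) (j : Fin N) {τ : ℝ}
    (hR : ∀ᶠ q in nearby T Θ₀ τ, S.PB j q.1 q.2 = 0 ∧ S.conn q.1 q.2 i = some j) :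
    ConstNear T (S.allEventTimes T Θ₀ x₁ z₁) (fun t =>
      fderiv ℝ (fun Θ => z₁ i j Θ t) Θ₀ + fderiv ℝ (fun Θ => x₁ i Θ t) Θ₀) τ := by
  obtain ⟨W, hW, hWc⟩ := exists_nhds_fderiv_eq (T := T) (Θ₀ := Θ₀) (τ := τ) (F := F)
    (φ := fun Θ s => z₁ i j Θ s + x₁ i Θ s) (ρ := fun s => a₁ i s)
    (R := fun Θ s => S.PB j Θ s = 0 ∧ S.conn Θ s i = some j) hF
    (fun Θ hΘ => ((h₁.state Θ hΘ).z_cont i j).add ((h₁.state Θ hΘ).x_cont i))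
    (fun Θ hΘ => by
      obtain ⟨C, hC, hd⟩ := (h₁.state Θ hΘ).exists_finite_hasDerivAt hS hΘ h₁.arrival_nonneg
      refine ⟨C, hC, fun s hs hsC hR => ?_⟩
      have := ((hd s hs hsC).2.1 i j).add ((hd s hs hsC).1 i)
      rwa [outflow_of_PB_eq_zero hR.1, sub_zero, hS.inflow_of_conn_eq hR.2
        (h₁.arrival_nonneg i s (Ioo_subset_Icc_self hs)), sub_add_cancel] at this) hR
  refine ⟨W, hW, fun u hu v hv huI hvI hug hvg => ?_⟩
  have := hWc u hu v hv huI hvI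
  rwa [fderiv_fun_add (h₁.differentiableAt_z hS hF i j hvI hvg)
    (h₁.differentiableAt_x hS hF i hvI hvg),
    fderiv_fun_add (h₁.differentiableAt_z hS hF i j huI hug)
    (h₁.differentiableAt_x hS hF i huI hug)] at this

/-- Out of range, positive contents change only by delivery at a rate fixed by the geometry. Within
range nothing is delivered, and collection is fixed by the geometry if `X_i > 0`. For an empty
target, `Z + X` and `fderiv_x_eq` settle the connected agent, and only a range event at that target
needs the small-jump estimate. -/
theorem fderiv_z_eq (i : Fin M) (j : Fin N) {t : ℝ} (ht : t ∈ Icc 0 T)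
    (htB : t ∉ S.allEventTimes T Θ₀ x₁ z₁) :
    fderiv ℝ (fun Θ => z₁ i j Θ t) Θ₀ = fderiv ℝ (fun Θ => z₂ i j Θ t) Θ₀ := by
  have hBeq := allEventTimes_eq hE
  have hst₁ := h₁.state Θ₀ (mem_of_mem_nhds hF)
  set Δ : ℝ → (Params d →L[ℝ] ℝ) := fun t =>
    fderiv ℝ (fun Θ => z₁ i j Θ t) Θ₀ - fderiv ℝ (fun Θ => z₂ i j Θ t) Θ₀ with hΔ
  have hΔ0 : Δ 0 = 0 := by
    rw [hΔ]
    simp only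
    rw [h₁.fderiv_z_zero hF, h₂.fderiv_z_zero hF, sub_self]
  have hzero : ∀ s ∈ Icc 0 T, z₁ i j Θ₀ s = 0 → Δ s = 0 := fun s hs h0 => by
    simp only [hΔ]
    rw [h₁.fderiv_z_eq_zero hF i j hs h0,
      h₂.fderiv_z_eq_zero hF i j hs (z_eq_zero_of_eq_zero h₁ h₂ hE hT hF hS i j hs h0), sub_zero]
  refine sub_eq_zero.1 (eq_zero_of_constNear_or h₁.finite_allEventTimes hΔ0 (fun τ hτ => ?_)
    t ht htB)
  rcases lt_or_ge (S.r i j) (S.D i j Θ₀ τ) with hD | hD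
  · have hout := hS.eventually_out_of_range hF hτ hD
    rcases (hst₁.z_nonneg i j τ hτ).eq_or_lt with h0 | hpos
    · by_cases hτB : τ ∈ S.allEventTimes T Θ₀ x₁ z₁
      · refine Or.inr ⟨hτB, fun hτT _ ε hε => ?_⟩
        filter_upwards [h₁.z_eventually_zero_of_out_of_range hS hF ⟨hτ.1, hτT⟩ hD h0.symm,
          Icc_mem_nhdsGT_of_lt hτ.1 hτT] with v hv hvI _
        rw [hzero v hvI hv, norm_zero]
        exact hε.le
      · refine Or.inl ⟨_, eventually_nhdsWithin_Icc (p := fun u => z₁ i j Θ₀ u = 0) hτ h0.symm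
          (fun hp => (eventually_zero_or_pos_nhdsLT (hst₁.z_cont i j) (hst₁.z_nonneg i j)
            (h₁.finite (.zetaZero i j)) ⟨hp, hτ.2⟩).resolve_right fun h' =>
              hτB (mem_allEventTimes (e := .zetaZero i j) ⟨hp, hτ.2, h0.symm, h'⟩))
          (fun hp => h₁.z_eventually_zero_of_out_of_range hS hF ⟨hτ.1, hp⟩ hD h0.symm),
          fun u hu v hv huI hvI _ _ => ?_⟩
        rw [hzero u huI hu, hzero v hvI hv]
    · left
      have hpos₂ := z_pos_of_pos h₁ h₂ hE hT hF hS i j hτ hpos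
      refine constNear_fderiv_z_sub h₁ h₂ hE hF hS i j (R := fun Θ s =>
        S.r i j < S.D i j Θ s ∧ 0 < z₁ i j Θ s ∧ 0 < z₂ i j Θ s) (fun Θ hΘ => ?_)
        (hout.and (((h₁.tendsto_z hS hF hT i j hτ).eventually_const_lt hpos).and
          ((h₂.tendsto_z hS hF hT i j hτ).eventually_const_lt hpos₂)))
      obtain ⟨C₁, hC₁, hd₁⟩ := (h₁.state Θ hΘ).exists_finite_hasDerivAt hS hΘ h₁.arrival_nonneg
      obtain ⟨C₂, hC₂, hd₂⟩ := (h₂.state Θ hΘ).exists_finite_hasDerivAt hS hΘ h₂.arrival_nonneg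
      refine ⟨C₁ ∪ C₂, hC₁.union hC₂, fun s hs hsC hR => ?_⟩
      have := ((hd₁ s hs fun h => hsC (Or.inl h)).2.1 i j).sub
        ((hd₂ s hs fun h => hsC (Or.inr h)).2.1 i j)
      have hne := hS.conn_ne_of_lt hΘ (Ioo_subset_Icc_self hs) hR.1
      rwa [outflow_of_pos hR.2.1, outflow_of_pos hR.2.2, inflow_of_conn_ne hne,
        inflow_of_conn_ne hne, sub_self] at this
  have hPB := hS.eventually_PB_eq_zero hF hτ hD
  rcases (hst₁.x_nonneg i τ hτ).eq_or_lt with h0 | hxpos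
  swap
  · left
    have hxpos₂ := x_pos_of_pos h₁ h₂ hE hF i hτ hxpos
    exact constNear_fderiv_z_sub h₁ h₂ hE hF hS i j
      (fun Θ hΘ => exists_finite_hasDerivAt_z_sub_of_x_pos h₁ h₂ hS i j hΘ)
      (hPB.and (((h₁.tendsto_x hS hF hT i hτ).eventually_const_lt hxpos).and
        ((h₂.tendsto_x hS hF hT i hτ).eventually_const_lt hxpos₂)))
  by_cases hδ : ∀ k, ¬ HitsZero T (S.Dplus i k Θ₀) τ ∧ ¬ LeavesZero T (S.Dplus i k Θ₀) τ
  · left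
    have hconn := hS.eventually_conn_eq hτ hδ
    by_cases hj : S.conn Θ₀ τ i = some j
    · have hR : ∀ᶠ q in nearby T Θ₀ τ, S.PB j q.1 q.2 = 0 ∧ S.conn q.1 q.2 i = some j :=
        hPB.and (hconn.mono fun q hq => hq.trans hj)
      obtain ⟨W₁, hW₁, hc₁⟩ := constNear_fderiv_z_add_fderiv_x h₁ hF hS i j hR
      obtain ⟨W₂, hW₂, hc₂⟩ := constNear_fderiv_z_add_fderiv_x h₂ hF hS i j hR
      refine ⟨W₁ ∩ W₂, inter_mem hW₁ hW₂, fun u hu v hv huI hvI hug hvg => ?_⟩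
      have e₁ := hc₁ u hu.1 v hv.1 huI hvI hug hvg
      have e₂ := hc₂ u hu.2 v hv.2 huI hvI (hBeq ▸ hug) (hBeq ▸ hvg)
      simp only at e₁ e₂
      rw [fderiv_x_eq h₁ h₂ hE hT hF hS i hvI hvg, fderiv_x_eq h₁ h₂ hE hT hF hS i huI hug] at e₁
      simp only [hΔ]
      rw [← add_sub_add_right_eq_sub _ _ (fderiv ℝ (fun Θ => x₂ i Θ v) Θ₀), e₁, e₂,
        add_sub_add_right_eq_sub]
    · refine constNear_fderiv_z_sub h₁ h₂ hE hF hS i j (R := fun Θ s =>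
        S.PB j Θ s = 0 ∧ S.conn Θ s i ≠ some j) (fun Θ hΘ => ?_)
        (hPB.and (hconn.mono fun q hq => by rwa [hq]))
      obtain ⟨C₁, hC₁, hd₁⟩ := (h₁.state Θ hΘ).exists_finite_hasDerivAt hS hΘ h₁.arrival_nonneg
      obtain ⟨C₂, hC₂, hd₂⟩ := (h₂.state Θ hΘ).exists_finite_hasDerivAt hS hΘ h₂.arrival_nonneg
      refine ⟨C₁ ∪ C₂, hC₁.union hC₂, fun s hs hsC hR => ?_⟩
      have := ((hd₁ s hs fun h => hsC (Or.inl h)).2.1 i j).sub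
        ((hd₂ s hs fun h => hsC (Or.inr h)).2.1 i j)
      rwa [outflow_of_PB_eq_zero hR.1, outflow_of_PB_eq_zero hR.1, inflow_of_conn_ne hR.2,
        inflow_of_conn_ne hR.2, sub_self] at this
  · right
    obtain ⟨e, hei, heP, he⟩ : ∃ e : Event M N, (e ≠ .xiZero i ∧ e ≠ .xiPlus i) ∧
        (∀ i j, e ≠ .zetaPlus i j) ∧
        τ ∈ S.eventTimes T Θ₀ (fun i => x₁ i Θ₀) (fun i j => z₁ i j Θ₀) e := by
      push Not at hδ
      obtain ⟨k, hk⟩ := hδ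
      by_cases hh : HitsZero T (S.Dplus i k Θ₀) τ
      · exact ⟨.deltaZero i k, by simp, by simp, hh⟩
      · exact ⟨.deltaPlus i k, by simp, by simp, hk hh⟩
    -- The range event excludes a simultaneous hit or departure of `X_i`, so the target is empty on
    -- both sides of `τ`.
    have hxz : ∀ᶠ u in 𝓝[Icc 0 T] τ, x₁ i Θ₀ u = 0 :=
      h₁.x_eventually_zero hF i hτ h0.symm
        (fun hh => hei.1 (h₁.simple e (.xiZero i) heP (by simp) τ he hh))
        (fun hh => hei.2 (h₁.simple e (.xiPlus i) heP (by simp) τ he hh))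
    have hxz₂ : ∀ᶠ u in 𝓝[Icc 0 T] τ, x₂ i Θ₀ u = 0 := by
      filter_upwards [hxz, self_mem_nhdsWithin] with u hu huI
      exact x_eq_zero_of_eq_zero h₁ h₂ hE hF i huI hu
    refine ⟨mem_allEventTimes he, fun hτT hbef ε hε => ?_⟩
    have hj₁ := h₁.smallJump_fderiv_z hS hF ⟨hτ.1, hτT⟩ hxz hD
    have hj₂ := h₂.smallJump_fderiv_z hS hF ⟨hτ.1, hτT⟩ hxz₂ hD
    rw [← hBeq] at hj₂
    exact (hj₁.sub hj₂).eventually_norm_le h₁.finite_allEventTimes ⟨hτ.1, hτT⟩ hΔ0 hbef hε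

end TwoPaths

/-! ### Delivered data, by conservation. -/

section OnePath

variable {a : Fin M → ℝ → ℝ} {x : Fin M → Params d → ℝ → ℝ}
  {z : Fin M → Fin N → Params d → ℝ → ℝ} {y : Fin M → Params d → ℝ → ℝ}

/-- Data are conserved: what has arrived is at the target, on board, or delivered. -/
theorem hasFDerivAt_y (h : S.IsSamplePath T F Θ₀ a x z y) (hF : F ∈ 𝓝 Θ₀)
    (hS : S.Admissible T F Θ₀) (i : Fin M) {t : ℝ} (ht : t ∈ Icc 0 T)
    (htB : t ∉ S.allEventTimes T Θ₀ x z) :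
    HasFDerivAt (fun Θ => y i Θ t) (fderiv ℝ (S.x₀ i) Θ₀ + ∑ j, fderiv ℝ (S.z₀ i j) Θ₀ +
      fderiv ℝ (S.y₀ i) Θ₀ - fderiv ℝ (fun Θ => x i Θ t) Θ₀ -
      ∑ j, fderiv ℝ (fun Θ => z i j Θ t) Θ₀) Θ₀ := by
  have hΘ₀ := mem_of_mem_nhds hF
  -- The last bracket is the total arrival up to `t`, read off from the path for `Θ₀`; it does not
  -- depend on `Θ`.
  have hcons : ∀ Θ ∈ F, y i Θ t = S.x₀ i Θ + ∑ j, S.z₀ i j Θ + S.y₀ i Θ - x i Θ t -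
      ∑ j, z i j Θ t + (x i Θ₀ t + ∑ j, z i j Θ₀ t + y i Θ₀ t -
        (S.x₀ i Θ₀ + ∑ j, S.z₀ i j Θ₀ + S.y₀ i Θ₀)) := by
    intro Θ hΘ
    have hcont : ∀ Θ ∈ F, ContinuousOn (fun s => x i Θ s + ∑ j, z i j Θ s + y i Θ s) (Icc 0 t) :=
      fun Θ hΘ => ((((h.state Θ hΘ).x_cont i).add (continuousOn_finsetSum _ fun j _ =>
        (h.state Θ hΘ).z_cont i j)).add ((h.state Θ hΘ).y_cont i)).mono
          (Icc_subset_Icc_right ht.2)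
    have hder : ∀ Θ ∈ F, ∃ C : Set ℝ, C.Finite ∧ ∀ s ∈ Ioo 0 T, s ∉ C →
        HasDerivAt (fun s => x i Θ s + ∑ j, z i j Θ s + y i Θ s) (a i s) s := by
      intro Θ hΘ
      obtain ⟨C, hC, hd⟩ := (h.state Θ hΘ).exists_finite_hasDerivAt hS hΘ h.arrival_nonneg
      refine ⟨C, hC, fun s hs hsC => ?_⟩
      obtain ⟨d₁, d₂, d₃⟩ := hd s hs hsC
      refine (((d₁ i).add (HasDerivAt.fun_sum fun j (_ : j ∈ Finset.univ) => d₂ i j)).add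
        (d₃ i)).congr_deriv ?_
      rw [Finset.sum_sub_distrib, hS.sum_inflow (h.arrival_nonneg i s (Ioo_subset_Icc_self hs))
        fun j _ => Finset.mem_univ j]
      ring
    obtain ⟨C₁, hC₁, hd₁⟩ := hder Θ hΘ
    obtain ⟨C₂, hC₂, hd₂⟩ := hder Θ₀ hΘ₀
    have := sub_eq_sub_of_deriv_eq_off_finite (hC₁.union hC₂) ht.1 (hcont Θ hΘ) (hcont Θ₀ hΘ₀)
      fun s hs hsC => by
        have hsI : s ∈ Ioo 0 T := ⟨hs.1, hs.2.trans_le ht.2⟩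
        exact ⟨a i s, hd₁ s hsI fun h => hsC (Or.inl h), hd₂ s hsI fun h => hsC (Or.inr h)⟩
    simp only [(h.state Θ hΘ).x_init, (h.state Θ hΘ).z_init, (h.state Θ hΘ).y_init,
      (h.state Θ₀ hΘ₀).x_init, (h.state Θ₀ hΘ₀).z_init, (h.state Θ₀ hΘ₀).y_init] at this
    linarith
  refine HasFDerivAt.congr_of_eventuallyEq ?_ (Filter.eventually_of_mem hF hcons)
  refine HasFDerivAt.add_const _ ?_
  refine ((((hS.x₀_diff i).hasFDerivAt.add (HasFDerivAt.fun_sum fun j _ =>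
    (hS.z₀_diff i j).hasFDerivAt)).add (hS.y₀_diff i).hasFDerivAt).sub
      (h.differentiableAt_x hS hF i ht (Or.inr htB)).hasFDerivAt).sub
    (HasFDerivAt.fun_sum fun j _ => (h.differentiableAt_z hS hF i j ht (Or.inr htB)).hasFDerivAt)

end OnePath

end IsSamplePath

end Setting

end DataHarvesting

/-! ### The maps, defined through reference sample paths. -/

open DataHarvesting in
theorem corollary1 {M N : ℕ} {d : Fin N → ℕ} (S : Setting M N d) (T : ℝ) (hT : 0 < T)
    (F : Set (Params d)) (Θ₀ : Params d) (hF : F ∈ 𝓝 Θ₀) (hS : S.Admissible T F Θ₀) :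
    ∃ (ΦX : (Event M N → Set ℝ) → Fin M → ℝ → (Params d →L[ℝ] ℝ))
      (ΦZ : (Event M N → Set ℝ) → Fin M → Fin N → ℝ → (Params d →L[ℝ] ℝ))
      (ΦY : (Event M N → Set ℝ) → Fin M → ℝ → (Params d →L[ℝ] ℝ)),
      ∀ (Ω : Type*) [MeasurableSpace Ω] (ℙ : Measure Ω) [IsProbabilityMeasure ℙ]
        (σ : Fin M → ℝ → Ω → ℝ)
        (X : Fin M → Params d → ℝ → Ω → ℝ)
        (Z : Fin M → Fin N → Params d → ℝ → Ω → ℝ)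
        (Y : Fin M → Params d → ℝ → Ω → ℝ),
        (∀ i t, Measurable (σ i t)) →
        (∀ᵐ ω ∂ℙ, S.IsSamplePath T F Θ₀ (fun i t => σ i t ω) (fun i Θ t => X i Θ t ω)
          (fun i j Θ t => Z i j Θ t ω) (fun i Θ t => Y i Θ t ω)) →
        ∀ᵐ ω ∂ℙ, ∀ E : Event M N → Set ℝ,
          E = S.eventTimes T Θ₀ (fun i t => X i Θ₀ t ω) (fun i j t => Z i j Θ₀ t ω) →
          ∀ t ∈ Icc 0 T, (∀ e, t ∉ E e) →
            (∀ i, HasFDerivAt (fun Θ => X i Θ t ω) (ΦX E i t) Θ₀) ∧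
            (∀ i j, HasFDerivAt (fun Θ => Z i j Θ t ω) (ΦZ E i j t) Θ₀) ∧
            (∀ i, HasFDerivAt (fun Θ => Y i Θ t ω) (ΦY E i t) Θ₀) := by
  classical
  -- a reference sample path for every event record that occurs at all
  have href : ∀ E : Event M N → Set ℝ, ∃ (x : Fin M → Params d → ℝ → ℝ)
      (z : Fin M → Fin N → Params d → ℝ → ℝ),
      (∃ a' x' z' y', S.IsSamplePath T F Θ₀ a' x' z' y' ∧
        E = S.eventTimes T Θ₀ (fun i => x' i Θ₀) (fun i j => z' i j Θ₀)) →
      ∃ a y, S.IsSamplePath T F Θ₀ a x z y ∧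
        E = S.eventTimes T Θ₀ (fun i => x i Θ₀) (fun i j => z i j Θ₀) := by
    intro E
    by_cases hE : ∃ a' x' z' y', S.IsSamplePath T F Θ₀ a' x' z' y' ∧
        E = S.eventTimes T Θ₀ (fun i => x' i Θ₀) (fun i j => z' i j Θ₀)
    · obtain ⟨a, x, z, y, h⟩ := hE
      exact ⟨x, z, fun _ => ⟨a, y, h⟩⟩
    -- A record that no sample path produces gets a default value that is never used.
    · exact ⟨fun _ _ _ => 0, fun _ _ _ _ => 0, fun h => absurd h hE⟩
  choose x z hxz using href
  -- Reference paths are deterministic, so the maps depend on no probability space or arrival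
  -- process.
  refine ⟨fun E i t => fderiv ℝ (fun Θ => x E i Θ t) Θ₀,
    fun E i j t => fderiv ℝ (fun Θ => z E i j Θ t) Θ₀,
    fun E i t => fderiv ℝ (S.x₀ i) Θ₀ + ∑ j, fderiv ℝ (S.z₀ i j) Θ₀ +
      fderiv ℝ (S.y₀ i) Θ₀ - fderiv ℝ (fun Θ => x E i Θ t) Θ₀ -
      ∑ j, fderiv ℝ (fun Θ => z E i j Θ t) Θ₀, ?_⟩
  intro Ω _ ℙ _ σ X Z Y _ hpath
  filter_upwards [hpath] with ω h E hE t ht hev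
  obtain ⟨a, y, hr, hrE⟩ := hxz E ⟨_, _, _, _, h, hE⟩
  have hEE := hE.symm.trans hrE
  have htB : t ∉ S.allEventTimes T Θ₀ (fun i Θ t => X i Θ t ω) (fun i j Θ t => Z i j Θ t ω) := by
    intro hm
    obtain ⟨e, he⟩ := mem_iUnion.1 hm
    exact hev e (by rw [hE]; exact he)
  have hX : ∀ i, fderiv ℝ (fun Θ => X i Θ t ω) Θ₀ = fderiv ℝ (fun Θ => x E i Θ t) Θ₀ := fun i =>
    Setting.IsSamplePath.fderiv_x_eq h hr hEE hT hF hS i ht (Or.inr htB)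
  have hZ : ∀ i j, fderiv ℝ (fun Θ => Z i j Θ t ω) Θ₀ = fderiv ℝ (fun Θ => z E i j Θ t) Θ₀ :=
    fun i j => Setting.IsSamplePath.fderiv_z_eq h hr hEE hT hF hS i j ht htB
  refine ⟨fun i => ?_, fun i j => ?_, fun i => ?_⟩
  · rw [← hX]
    exact (h.differentiableAt_x hS hF i ht (Or.inr htB)).hasFDerivAt
  · rw [← hZ]
    exact (h.differentiableAt_z hS hF i j ht (Or.inr htB)).hasFDerivAt
  · have := h.hasFDerivAt_y hF hS i ht htB
    simp only [hX, hZ] at this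
    exact this
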